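/- Let $\Omega\subset\mathbb R^d$ be a bounded domain, $T>0$, $p\in(1,2)$, $\frac1p+\frac1{p'}=1$, $m\in\mathbb N$, and put $\Omega_T=(0,T)\times\Omega$. All function spaces below consist of $\mathbb R^m$-valued functions. $W^{1,p}_0(\Omega)$ is the closure of $C_c^\infty(\Omega)$ in $W^{1,p}(\Omega)$, $W^{-1,p'}(\Omega)$ is its dual, $(f,g)=\int_\Omega f\cdot g\,dx$, and $V=L^{p'}(\Omega)\cap W^{1,p}_0(\Omega)$ with dual $V'$ and duality pairing $\langle\cdot,\cdot\rangle_V$. The space $V$ is embedded in $V'$ by $(\cdot,\cdot)$; $f\in L^p(\Omega)$ acts on $V$ by $z\mapsto(f,z)$, and $g\in W^{-1,p'}(\Omega)$ acts on $V$ by restriction, so that $L^p(0,T;L^p(\Omega))+L^{p'}(0,T;W^{-1,p'}(\Omega))$ consists of $V'$-valued functions. Let $$W=\{u\in L^\infty(\Omega_T)\cap L^p(0,T;W^{1,p}_0(\Omega)) \;:\; \partial_t u\in L^p(0,T;L^p(\Omega))+L^{p'}(0,T;W^{-1,p'}(\Omega))\},$$ where $\partial_t u$ is the time derivative in the sense of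 distributions on $(0,T)$ with values in $V'$, i.e. $\int_0^T\varphi'(t)\,u(t)\,dt=-\int_0^T\varphi(t)\,\partial_tu(t)\,dt$ in $V'$ for all $\varphi\in C_c^\infty((0,T))$. Then every $u\in W$ has a representative in $C([0,T];L^2(\Omega))$, whose value at $t\in[0,T]$ is denoted by $u(t)$. Moreover, for all $u,v\in W$ the functions $\tau\mapsto\langle u(\tau),\partial_\tau v(\tau)\rangle_V$ and $\tau\mapsto\langle v(\tau),\partial_\tau u(\tau)\rangle_V$ are integrable on $(0,T)$, and for all $t\in[0,T]$ $$\int_0^t\langle u,\partial_\tau v\rangle_V\,d\tau=(u(t),v(t))-(u(0),v(0))-\int_0^t\langle v,\partial_\tau u\rangle_V\,d\tau .$$ -/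

import Mathlib

open MeasureTheory Set
open scoped ENNReal ContDiff

noncomputable section

namespace ParabolicIBP

/-- Euclidean space `ℝᵈ`. -/
abbrev E (d : ℕ) := EuclideanSpace ℝ (Fin d)

variable {d : ℕ}

/-- `L^q(Ω; X)`. -/
abbrev LSp (Ω : Set (E d)) (X : Type) [NormedAddCommGroup X] (q : ℝ≥0∞) :=
  Lp X q ((volume : Measure (E d)).restrict Ω)

/-- `φ ∈ C_c^∞(Ω; ℝᵐ)`. -/
structure IsTestFun {m : ℕ} (Ω : Set (E d)) (φ : E d → E m) : Prop where
  smooth : ContDiff ℝ ∞ φ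
  compact : HasCompactSupport φ
  supp : tsupport φ ⊆ Ω

/-- The linear space of the pairs `(φ, ∇φ)`, `φ ∈ C_c^∞(Ω; ℝᵐ)`, inside `L^p × L^p`. -/
def testPairs (Ω : Set (E d)) (m : ℕ) (p : ℝ≥0∞) :
    Submodule ℝ (LSp Ω (E m) p × LSp Ω (E d →L[ℝ] E m) p) where
  carrier := {w | ∃ φ : E d → E m, IsTestFun Ω φ ∧
    w.1 =ᵐ[volume.restrict Ω] φ ∧ w.2 =ᵐ[volume.restrict Ω] fderiv ℝ φ}
  zero_mem' := by
    refine ⟨0, ⟨contDiff_const, HasCompactSupport.zero, by simp [tsupport]⟩,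
      Lp.coeFn_zero _ _ _, ?_⟩
    have h : fderiv ℝ (0 : E d → E m) = 0 := by
      funext x
      simp
    rw [h]
    exact Lp.coeFn_zero _ _ _
  add_mem' := by
    rintro w w' ⟨φ, hφ, h1, h2⟩ ⟨ψ, hψ, k1, k2⟩
    refine ⟨φ + ψ, ⟨hφ.smooth.add hψ.smooth, hφ.compact.add hψ.compact,
      (tsupport_add φ ψ).trans (union_subset hφ.supp hψ.supp)⟩, ?_, ?_⟩
    · exact (Lp.coeFn_add w.1 w'.1).trans (h1.add k1)
    · refine (Lp.coeFn_add w.2 w'.2).trans ((h2.add k2).trans (Filter.Eventually.of_forall ?_))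
      intro x
      exact (fderiv_add (hφ.smooth.differentiable (by simp) x)
        (hψ.smooth.differentiable (by simp) x)).symm
  smul_mem' := by
    rintro c w ⟨φ, hφ, h1, h2⟩
    refine ⟨c • φ, ⟨contDiff_const.smul hφ.smooth, hφ.compact.smul_left,
      (closure_mono (Function.support_const_smul_subset c φ)).trans hφ.supp⟩, ?_, ?_⟩
    · exact (Lp.coeFn_smul c w.1).trans (h1.const_smul c)
    · refine (Lp.coeFn_smul c w.2).trans ((h2.const_smul c).trans
        (Filter.Eventually.of_forall ?_))
      intro x
      exact (fderiv_const_smul (hφ.smooth.differentiable (by simp) x) c).symm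

/-- `W_0^{1,p}(Ω; ℝᵐ)`: the closure of `C_c^∞(Ω; ℝᵐ)` in the `W^{1,p}`-norm. A function `w` is
represented by the pair `(w, ∇w)` in `L^p × L^p`, on which the `W^{1,p}`-norm is (equivalent to)
the product norm. -/
def W01 (Ω : Set (E d)) (m : ℕ) (p : ℝ≥0∞) [Fact (1 ≤ p)] : Type :=
  (testPairs Ω m p).topologicalClosure

section Spaces

variable {Ω : Set (E d)} {m : ℕ} {p p' : ℝ≥0∞} [Fact (1 ≤ p)] [Fact (1 ≤ p')]

instance : NormedAddCommGroup (W01 Ω m p) :=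
  inferInstanceAs (NormedAddCommGroup (testPairs Ω m p).topologicalClosure)

instance : NormedSpace ℝ (W01 Ω m p) :=
  inferInstanceAs (NormedSpace ℝ (testPairs Ω m p).topologicalClosure)

/-- The pair `(w, ∇w)` of an element `w` of `W_0^{1,p}`, as a linear map. -/
def W01.pair : W01 Ω m p →ₗ[ℝ] LSp Ω (E m) p × LSp Ω (E d →L[ℝ] E m) p :=
  (testPairs Ω m p).topologicalClosure.subtype

/-- An element of `W_0^{1,p}` as an element of `L^p`. -/
def W01.fn (w : W01 Ω m p) : LSp Ω (E m) p := w.pair.1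

theorem W01.fn_add (w w' : W01 Ω m p) : (w + w').fn = w.fn + w'.fn := by
  simp [W01.fn]

theorem W01.fn_smul (c : ℝ) (w : W01 Ω m p) : (c • w).fn = c • w.fn := by
  simp [W01.fn]

theorem W01.fn_zero : (0 : W01 Ω m p).fn = 0 := by
  simp [W01.fn]

/-- The pairs of an element of `W_0^{1,p}` and an element of `L^{p'}` that are the same
function. -/
def interSubmodule (Ω : Set (E d)) (m : ℕ) (p p' : ℝ≥0∞) [Fact (1 ≤ p)] [Fact (1 ≤ p')] :
    Submodule ℝ (W01 Ω m p × LSp Ω (E m) p') where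
  carrier := {z | z.1.fn =ᵐ[volume.restrict Ω] z.2}
  zero_mem' := by
    change (0 : W01 Ω m p).fn =ᵐ[volume.restrict Ω] (0 : LSp Ω (E m) p')
    rw [W01.fn_zero]
    exact (Lp.coeFn_zero _ _ _).trans (Lp.coeFn_zero _ _ _).symm
  add_mem' := by
    intro z y hz hy
    change z.1.fn =ᵐ[volume.restrict Ω] z.2 at hz
    change y.1.fn =ᵐ[volume.restrict Ω] y.2 at hy
    change (z.1 + y.1).fn =ᵐ[volume.restrict Ω] (z.2 + y.2 : LSp Ω (E m) p')
    rw [W01.fn_add]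
    exact (Lp.coeFn_add _ _).trans ((hz.add hy).trans (Lp.coeFn_add z.2 y.2).symm)
  smul_mem' := by
    intro c z hz
    change z.1.fn =ᵐ[volume.restrict Ω] z.2 at hz
    change (c • z.1).fn =ᵐ[volume.restrict Ω] (c • z.2 : LSp Ω (E m) p')
    rw [W01.fn_smul]
    exact (Lp.coeFn_smul c _).trans ((hz.const_smul c).trans (Lp.coeFn_smul c z.2).symm)

/-- `V = L^{p'}(Ω; ℝᵐ) ∩ W_0^{1,p}(Ω; ℝᵐ)` with (a norm equivalent to) the norm of the
intersection. -/
def V (Ω : Set (E d)) (m : ℕ) (p p' : ℝ≥0∞) [Fact (1 ≤ p)] [Fact (1 ≤ p')] : Type :=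
  interSubmodule Ω m p p'

instance : NormedAddCommGroup (V Ω m p p') :=
  inferInstanceAs (NormedAddCommGroup (interSubmodule Ω m p p'))

instance : NormedSpace ℝ (V Ω m p p') :=
  inferInstanceAs (NormedSpace ℝ (interSubmodule Ω m p p'))

/-- An element of `V` as an element of `W_0^{1,p}`. -/
def V.sob (z : V Ω m p p') : W01 Ω m p :=
  ((interSubmodule Ω m p p').subtype z).1

/-- An element of `V` as a function on `Ω` (an element of `L^{p'}`). -/
def V.fn (z : V Ω m p p') : LSp Ω (E m) p' :=
  ((interSubmodule Ω m p p').subtype z).2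

/-- `F ∈ L^p(0,T; L^p(Ω)) + L^{p'}(0,T; W^{-1,p'}(Ω))`, as a function with values in the dual `V'`
of `V`. Here `W^{-1,p'}` is the dual of `W_0^{1,p}`, and `f ∈ L^p(Ω)` acts on `V` by
`z ↦ ∫ f · z dx`. -/
def MemSum (T : ℝ) (F : ℝ → StrongDual ℝ (V Ω m p p')) : Prop :=
  ∃ (f : ℝ → LSp Ω (E m) p) (g : ℝ → StrongDual ℝ (W01 Ω m p)),
    MemLp f p (volume.restrict (Ioo 0 T)) ∧ MemLp g p' (volume.restrict (Ioo 0 T)) ∧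
    ∀ᵐ t ∂(volume.restrict (Ioo 0 T)), ∀ z : V Ω m p p',
      F t z = (∫ x in Ω, inner ℝ (f t x) (z.fn x)) + g t z.sob

/-- `∂_t u = F` on `(0,T)` in the sense of distributions with values in `V'`, where `V` is embedded
in `V'` by the `L²`-product `(·,·)`:
`∫₀ᵀ φ'(t) u(t) dt = - ∫₀ᵀ φ(t) F(t) dt` in `V'` for all `φ ∈ C_c^∞((0,T))`. -/
structure IsTimeDeriv (T : ℝ) (u : ℝ → V Ω m p p')
    (F : ℝ → StrongDual ℝ (V Ω m p p')) : Prop where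
  integrable : IntegrableOn F (Ioo 0 T)
  eq : ∀ φ : ℝ → ℝ, ContDiff ℝ ∞ φ → HasCompactSupport φ → tsupport φ ⊆ Ioo 0 T →
    ∀ z : V Ω m p p',
      ∫ t in Ioo 0 T, deriv φ t * ∫ x in Ω, inner ℝ ((u t).fn x) (z.fn x)
        = - ∫ t in Ioo 0 T, φ t * F t z

/-- The space `W` of all `u ∈ L^∞(Ω_T) ∩ L^p(0,T; W_0^{1,p}(Ω))` with
`∂_t u ∈ L^p(0,T; L^p(Ω)) + L^{p'}(0,T; W^{-1,p'}(Ω))`, `Ω_T = (0,T) × Ω`. For bounded `Ω` such a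
`u` has `u(t) ∈ W_0^{1,p}(Ω) ∩ L^∞(Ω) ⊆ V` for almost every `t`. -/
structure MemW (T : ℝ) (u : ℝ → V Ω m p p') : Prop where
  memLp_sob : MemLp (fun t => (u t).sob) p (volume.restrict (Ioo 0 T))
  memLp_top : ∃ U : ℝ × E d → E m, MemLp U ∞ (volume.restrict (Ioo 0 T ×ˢ Ω)) ∧
    ∀ᵐ t ∂(volume.restrict (Ioo 0 T)), (u t).fn =ᵐ[volume.restrict Ω] fun x => U (t, x)
  deriv : ∃ F : ℝ → StrongDual ℝ (V Ω m p p'), MemSum T F ∧ IsTimeDeriv T u F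

/-- `c` is the representative of `u` in `C([0,T]; L²(Ω))`. -/
structure IsContRep (T : ℝ) (u : ℝ → V Ω m p p') (c : ℝ → LSp Ω (E m) 2) : Prop where
  cont : ContinuousOn c (Icc 0 T)
  ae_eq : ∀ᵐ t ∂(volume.restrict (Ioo 0 T)), c t =ᵐ[volume.restrict Ω] (u t).fn

end Spaces

end ParabolicIBP

end

/-!
Write `u' = f + g` with `f ∈ L^p(0,T; L^p)` and `g ∈ L^{p'}(0,T; W^{-1,p'})`. As `u` is bounded and
`Ω` has finite measure, `u` takes its values in a bounded subset of `L^{p'}`, on which the topology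
of `V` is that of `W_0^{1,p}`. Hence `u` is measurable into `V`, and the two parts of `⟨u', v⟩` are
integrable by Hölder's inequality (`IsRegular`, `IsRegular.integrable_apply`).

The weak product rule `d/dt (u, v) = ⟨u', v⟩ + ⟨v', u⟩` is proved by doubling the time variable. The
equation of `u` is tested in `t` and that of `v` in `s` with the function `φ(t) ρ(s - t)`, where `ρ`
is a mollifier. In the sum of the two identities only `φ'` appears (`mollified_product_rule`), and
the continuity of translations in `L^q` for finite `q` allows `ρ` to shrink to the origin
(`tendsto_mollified_pairing`, `IsRegular.weak_product_rule`). The lemma of du Bois-Reymond turns the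
product rule into `(u(t), v(t)) = c + ∫₀ᵗ (⟨u', v⟩ + ⟨v', u⟩)` for almost every `t`
(`ae_eq_add_primitive`, `IsRegular.exists_inner_ae_eq`).

Taking `v = u`, one gets `‖u(t) - u(s)‖² = 2 ∫ₛᵗ ⟨u', u⟩ - 2 ∫ₛᵗ ⟨u', u(s)⟩` for almost all `s` and
`t`. On an interval `[a, b]` the right-hand side is at most the integral over `[a, b]` of a fixed
integrable function, if `s` is chosen such that `‖u(s)‖ᵖ` in `W_0^{1,p}` does not exceed its mean
(`IsRegular.exists_bound_norm_sub_sq`). So `u` is uniformly continuous into `L²` off a null set and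
extends to `[0,T]` (`IsRegular.exists_isContRep`). With continuous representatives the almost
everywhere identity holds at every `t ∈ [0,T]`, in particular at `t = 0`
(`IsRegular.inner_sub_inner_eq`).
-/

noncomputable section

namespace ParabolicIBP
open Filter Topology

/-! ### Pairings of mollified functions -/

section Mollification

variable {X Y : Type*} [NormedAddCommGroup X] [NormedSpace ℝ X]
  [NormedAddCommGroup Y] [NormedSpace ℝ Y]

/-- The translations act continuously on `L^{q'}` for `q' < ∞`, so by Hölder's inequality the
pairing with a fixed element of `L^q` depends continuously on the translation. -/
theorem continuous_integral_pairing_translate (L : X →L[ℝ] Y →L[ℝ] ℝ) {q q' : ℝ≥0∞}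
    [Fact (1 ≤ q)] [Fact (1 ≤ q')] [ENNReal.HolderConjugate q q'] (hq' : q' ≠ ⊤)
    {a : ℝ → X} {b : ℝ → Y} (ha : MemLp a q) (hb : MemLp b q') :
    Continuous fun r : ℝ => ∫ t, L (a t) (b (t + r)) := by
  have hmp : ∀ r : ℝ, MeasurePreserving (fun t : ℝ => t + r) volume volume :=
    fun r => measurePreserving_add_right volume r
  let g : C(ℝ, C(ℝ, ℝ)) :=
    (ContinuousMap.mk (fun z : ℝ × ℝ => z.2 + z.1) (by fun_prop)).curry
  have hg : ∀ r, MeasurePreserving (g r) volume volume := hmp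
  have hcont : Continuous fun r : ℝ => Lp.compMeasurePreserving (g r) (hg r) (hb.toLp b) :=
    continuous_const.compMeasurePreservingLp g.continuous hg hq'
  have key : ∀ r, ∫ t, L (a t) (b (t + r)) = L.lpPairing volume q q' (ha.toLp a)
      (Lp.compMeasurePreserving (g r) (hg r) (hb.toLp b)) := by
    intro r
    rw [ContinuousLinearMap.lpPairing_eq_integral]
    refine integral_congr_ae ?_
    have h2 : (fun t => hb.toLp b (t + r)) =ᵐ[volume] fun t => b (t + r) :=
      (hmp r).quasiMeasurePreserving.ae_eq_comp hb.coeFn_toLp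
    filter_upwards [ha.coeFn_toLp, h2,
      Lp.coeFn_compMeasurePreserving (hb.toLp b) (hg r)] with t h1 h2 h3
    rw [h1, h3]
    change _ = L (a t) (hb.toLp b (t + r))
    rw [h2]
  simp_rw [key]
  exact (ContinuousLinearMap.continuous _).comp hcont

theorem integrable_prod_bilin (L : X →L[ℝ] Y →L[ℝ] ℝ) {μ ν : Measure ℝ} [SFinite μ] [SFinite ν]
    {a : ℝ → X} {b : ℝ → Y} (ha : Integrable a μ) (hb : Integrable b ν) {k : ℝ × ℝ → ℝ}
    (hk : Continuous k) {C : ℝ} (hC : ∀ z, |k z| ≤ C) :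
    Integrable (fun z : ℝ × ℝ => k z * L (a z.1) (b z.2)) (μ.prod ν) := by
  have h1 : Integrable (fun z : ℝ × ℝ => L (a z.1) (b z.2)) (μ.prod ν) :=
    ha.op_fst_snd (op := fun x y => L x y) (by fun_prop) ⟨‖L‖, L.le_opNorm₂⟩ hb
  exact h1.bdd_mul hk.aestronglyMeasurable (Eventually.of_forall hC)

theorem exists_bound_normed (ρ : ContDiffBump (0 : ℝ)) :
    ∃ C, ∀ x, |ρ.normed volume x| ≤ C := by
  obtain ⟨C, hC⟩ := (ρ.hasCompactSupport_normed (μ := volume)).exists_bound_of_continuous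
    (ρ.contDiff_normed (μ := volume) (n := 0)).continuous
  exact ⟨C, hC⟩

/-- In the variables `(t, r) = (t, s - t)` the double integral is `∫ ρ(r) K(r) dr`, where
`K(r) = ∫ L (a t) (b (t + r)) dt` is continuous. -/
theorem tendsto_mollified_pairing (L : X →L[ℝ] Y →L[ℝ] ℝ) {q q' : ℝ≥0∞}
    [Fact (1 ≤ q)] [Fact (1 ≤ q')] [ENNReal.HolderConjugate q q'] (hq' : q' ≠ ⊤)
    {a : ℝ → X} {b : ℝ → Y} (ha : MemLp a q) (hb : MemLp b q')
    (ha1 : Integrable a) (hb1 : Integrable b)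
    {ρ : ℕ → ContDiffBump (0 : ℝ)} (hρ : Tendsto (fun n => (ρ n).rOut) atTop (𝓝 0)) :
    Tendsto (fun n => ∫ z : ℝ × ℝ, (ρ n).normed volume (z.2 - z.1) * L (a z.1) (b z.2)
      ∂(volume.prod volume)) atTop (𝓝 (∫ t, L (a t) (b t))) := by
  set K : ℝ → ℝ := fun r => ∫ t, L (a t) (b (t + r)) with hKdef
  have hK : Continuous K := continuous_integral_pairing_translate L hq' ha hb
  have hK0 : K 0 = ∫ t, L (a t) (b t) := by simp [hKdef]
  have key : ∀ n, ∫ z : ℝ × ℝ, (ρ n).normed volume (z.2 - z.1) * L (a z.1) (b z.2)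
      ∂(volume.prod volume) = ∫ r, (ρ n).normed volume r * K r := by
    intro n
    obtain ⟨C, hC⟩ := exists_bound_normed (ρ n)
    have hint := integrable_prod_bilin L ha1 hb1 (k := fun z => (ρ n).normed volume (z.2 - z.1))
      (((ρ n).contDiff_normed (n := 0)).continuous.comp (by fun_prop)) (fun z => hC _)
    have hmp := measurePreserving_prod_add (volume : Measure ℝ) (volume : Measure ℝ)
    have hint2 := hmp.integrable_comp_of_integrable hint
    have he : MeasurableEmbedding fun z : ℝ × ℝ => (z.1, z.1 + z.2) :=
      (MeasurableEquiv.shearAddRight ℝ).measurableEmbedding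
    rw [← hmp.integral_comp he, integral_prod_symm]
    · refine integral_congr_ae (Eventually.of_forall fun r => ?_)
      simp only [add_sub_cancel_left, hKdef]
      rw [integral_const_mul]
    · exact hint2
  simp_rw [key, ← hK0]
  have hc := ContDiffBump.convolution_tendsto_right (φ := ρ) (g := fun _ r => K (-r))
    (k := fun _ => (0 : ℝ)) (x₀ := 0) (z₀ := K 0) (μ := volume) hρ
    (Eventually.of_forall fun _ => (hK.comp continuous_neg).aestronglyMeasurable) ?_
    tendsto_const_nhds
  · simpa [convolution, smul_eq_mul] using hc
  · have : Tendsto (fun r => K (-r)) (𝓝 0) (𝓝 (K 0)) := by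
      simpa [Function.comp_def] using (hK.comp continuous_neg).tendsto 0
    exact this.comp tendsto_snd

theorem tendsto_mollified_pairing_restrict (L : X →L[ℝ] Y →L[ℝ] ℝ) {q q' : ℝ≥0∞}
    [Fact (1 ≤ q)] [Fact (1 ≤ q')] [ENNReal.HolderConjugate q q'] (hq' : q' ≠ ⊤)
    {S : Set ℝ} (hS : MeasurableSet S) [IsFiniteMeasure (volume.restrict S)]
    {a : ℝ → X} {b : ℝ → Y} (ha : MemLp a q (volume.restrict S))
    (hb : MemLp b q' (volume.restrict S))
    {ρ : ℕ → ContDiffBump (0 : ℝ)} (hρ : Tendsto (fun n => (ρ n).rOut) atTop (𝓝 0)) :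
    Tendsto (fun n => ∫ z : ℝ × ℝ, (ρ n).normed volume (z.2 - z.1) * L (a z.1) (b z.2)
      ∂((volume.restrict S).prod (volume.restrict S))) atTop (𝓝 (∫ t in S, L (a t) (b t))) := by
  have h := tendsto_mollified_pairing L hq' ((memLp_indicator_iff_restrict hS).2 ha)
    ((memLp_indicator_iff_restrict hS).2 hb)
    ((integrable_indicator_iff hS).2 (ha.integrable Fact.out))
    ((integrable_indicator_iff hS).2 (hb.integrable Fact.out)) hρ
  have e1 : ∀ t, L (S.indicator a t) (S.indicator b t) =
      S.indicator (fun t => L (a t) (b t)) t := by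
    intro t
    by_cases ht : t ∈ S <;> simp [ht]
  have e2 : ∀ n (z : ℝ × ℝ), (ρ n).normed volume (z.2 - z.1) *
      L (S.indicator a z.1) (S.indicator b z.2) = (S ×ˢ S).indicator
        (fun z : ℝ × ℝ => (ρ n).normed volume (z.2 - z.1) * L (a z.1) (b z.2)) z := by
    intro n z
    by_cases h1 : z.1 ∈ S <;> by_cases h2 : z.2 ∈ S <;> simp [indicator, h1, h2]
  simp only [e1, e2] at h
  simpa only [integral_indicator hS, integral_indicator (hS.prod hS), ← Measure.prod_restrict]
    using h

end Mollification

/-! ### The mollified product rule -/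

section ProductRule

variable {X : Type*} [NormedAddCommGroup X] [NormedSpace ℝ X]

/-- The weak equations of `u` and `v`, tested with `Φ(t, s) = φ(t) ρ(s - t)` in the variables `t`
and `s` respectively. Adding the two removes the derivative of `ρ`, since
`(∂ₜ + ∂ₛ) Φ = φ'(t) ρ(s - t)`. -/
theorem mollified_product_rule (J : X →L[ℝ] StrongDual ℝ X) (hJ : ∀ x y, J x y = J y x)
    {u v : ℝ → X} {u' v' : ℝ → StrongDual ℝ X} {S : Set ℝ} (hS : MeasurableSet S)
    (hu : IntegrableOn u S) (hv : IntegrableOn v S) (hu1 : IntegrableOn u' S)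
    (hv1 : IntegrableOn v' S)
    (hu2 : ∀ φ : ℝ → ℝ, ContDiff ℝ ∞ φ → HasCompactSupport φ → tsupport φ ⊆ S →
      ∀ z, ∫ t in S, deriv φ t * J (u t) z = - ∫ t in S, φ t * u' t z)
    (hv2 : ∀ φ : ℝ → ℝ, ContDiff ℝ ∞ φ → HasCompactSupport φ → tsupport φ ⊆ S →
      ∀ z, ∫ t in S, deriv φ t * J (v t) z = - ∫ t in S, φ t * v' t z)
    {φ : ℝ → ℝ} (hφ : ContDiff ℝ ∞ φ) (hφc : HasCompactSupport φ) (hφS : tsupport φ ⊆ S)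
    {ρ : ℝ → ℝ} (hρ : ContDiff ℝ ∞ ρ) (hρc : HasCompactSupport ρ)
    (hρS : ∀ t ∈ tsupport φ, ∀ r ∈ tsupport ρ, t + r ∈ S) :
    ∫ z : ℝ × ℝ, ρ (z.2 - z.1) * (deriv φ z.1 * J (u z.1) (v z.2))
          ∂((volume.restrict S).prod (volume.restrict S))
      = - ((∫ z : ℝ × ℝ, ρ (z.2 - z.1) * (φ z.1 * u' z.1 (v z.2))
          ∂((volume.restrict S).prod (volume.restrict S)))
        + ∫ z : ℝ × ℝ, ρ (z.2 - z.1) * (φ z.1 * v' z.2 (u z.1))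
          ∂((volume.restrict S).prod (volume.restrict S))) := by
  set μ := (volume : Measure ℝ).restrict S with hμ
  have hφ' : ContDiff ℝ ∞ (deriv φ) := (contDiff_infty_iff_deriv.1 hφ).2
  have hρ' : ContDiff ℝ ∞ (deriv ρ) := (contDiff_infty_iff_deriv.1 hρ).2
  obtain ⟨C1, hC1⟩ := hφc.exists_bound_of_continuous hφ.continuous
  obtain ⟨C2, hC2⟩ := hφc.deriv.exists_bound_of_continuous hφ'.continuous
  obtain ⟨C3, hC3⟩ := hρc.exists_bound_of_continuous hρ.continuous
  obtain ⟨C4, hC4⟩ := hρc.deriv.exists_bound_of_continuous hρ'.continuous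
  have bd : ∀ {f g : ℝ → ℝ} {A B : ℝ}, (∀ x, ‖f x‖ ≤ A) → (∀ x, ‖g x‖ ≤ B) →
      ∀ z : ℝ × ℝ, |f (z.2 - z.1) * g z.1| ≤ A * B := by
    intro f g A B hf hg z
    rw [abs_mul]
    exact mul_le_mul (hf _) (hg _) (abs_nonneg _) ((norm_nonneg _).trans (hf 0))
  have i1 := integrable_prod_bilin J hu hv (k := fun z => ρ (z.2 - z.1) * deriv φ z.1)
    (by have := hρ.continuous; have := hφ'.continuous; fun_prop) (bd hC3 hC2)
  have i2 := integrable_prod_bilin J hu hv (k := fun z => deriv ρ (z.2 - z.1) * φ z.1)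
    (by have := hρ'.continuous; have := hφ.continuous; fun_prop) (bd hC4 hC1)
  have i3 : Integrable (fun z : ℝ × ℝ => ρ (z.2 - z.1) * φ z.1 * u' z.1 (v z.2))
      (μ.prod μ) := integrable_prod_bilin (ContinuousLinearMap.id ℝ (StrongDual ℝ X)) hu1 hv
    (k := fun z => ρ (z.2 - z.1) * φ z.1)
    (by have := hρ.continuous; have := hφ.continuous; fun_prop) (bd hC3 hC1)
  have i4 : Integrable (fun z : ℝ × ℝ => ρ (z.2 - z.1) * φ z.1 * v' z.2 (u z.1))
      (μ.prod μ) := integrable_prod_bilin (ContinuousLinearMap.id ℝ (StrongDual ℝ X)).flip hu hv1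
    (k := fun z => ρ (z.2 - z.1) * φ z.1)
    (by have := hρ.continuous; have := hφ.continuous; fun_prop) (bd hC3 hC1)
  have dρ : ∀ x, HasDerivAt ρ (deriv ρ x) x :=
    fun x => (hρ.differentiable (by simp) x).hasDerivAt
  have dφ : ∀ x, HasDerivAt φ (deriv φ x) x :=
    fun x => (hφ.differentiable (by simp) x).hasDerivAt
  -- The equation of `u`, tested in the variable `z.1` for fixed `z.2`.
  have e1 : ∫ z : ℝ × ℝ, (ρ (z.2 - z.1) * deriv φ z.1 * J (u z.1) (v z.2)
      - deriv ρ (z.2 - z.1) * φ z.1 * J (u z.1) (v z.2)) ∂(μ.prod μ)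
      = - ∫ z : ℝ × ℝ, ρ (z.2 - z.1) * φ z.1 * u' z.1 (v z.2) ∂(μ.prod μ) := by
    have i12 : Integrable (fun z : ℝ × ℝ => ρ (z.2 - z.1) * deriv φ z.1 * J (u z.1) (v z.2)
      - deriv ρ (z.2 - z.1) * φ z.1 * J (u z.1) (v z.2)) (μ.prod μ) := i1.sub i2
    rw [integral_prod_symm _ i12, integral_prod_symm _ i3, ← integral_neg]
    refine integral_congr_ae (Eventually.of_forall fun s => ?_)
    have hd : ∀ t, HasDerivAt (fun t => ρ (s - t) * φ t)
        (ρ (s - t) * deriv φ t - deriv ρ (s - t) * φ t) t := by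
      intro t
      have h1 : HasDerivAt (fun t => ρ (s - t)) (- deriv ρ (s - t)) t := by
        simpa using (dρ (s - t)).comp_const_sub s t
      exact (h1.mul (dφ t)).congr_deriv (by ring)
    have := hu2 (fun t => ρ (s - t) * φ t)
      ((hρ.comp (contDiff_const.sub contDiff_id)).mul hφ) hφc.mul_left
      ((tsupport_mul_subset_right (f := fun t => ρ (s - t))).trans hφS) (v s)
    simp only [(hd _).deriv] at this
    simpa [sub_mul] using this
  -- The equation of `v`, tested in the variable `z.2` for fixed `z.1`.
  have e2 : ∫ z : ℝ × ℝ, deriv ρ (z.2 - z.1) * φ z.1 * J (u z.1) (v z.2) ∂(μ.prod μ)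
      = - ∫ z : ℝ × ℝ, ρ (z.2 - z.1) * φ z.1 * v' z.2 (u z.1) ∂(μ.prod μ) := by
    rw [integral_prod _ i2, integral_prod _ i4, ← integral_neg]
    rw [hμ]
    refine setIntegral_congr_fun hS fun t _ => ?_
    by_cases ht : t ∈ tsupport φ
    · have hd : ∀ s, HasDerivAt (fun s => ρ (s - t) * φ t) (deriv ρ (s - t) * φ t) s :=
        fun s => ((dρ (s - t)).comp_sub_const s t).mul_const _
      have hcs : HasCompactSupport fun s => ρ (s - t) :=
        hρc.comp_homeomorph (Homeomorph.subRight t)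
      have hts : tsupport (fun s => ρ (s - t) * φ t) ⊆ S := by
        refine (tsupport_mul_subset_left (f := fun s => ρ (s - t))).trans ?_
        intro s hs
        have : s - t ∈ tsupport ρ :=
          tsupport_comp_subset_preimage ρ (f := fun s => s - t) (by fun_prop) hs
        simpa using hρS t ht _ this
      have := hv2 (fun s => ρ (s - t) * φ t)
        ((hρ.comp (contDiff_id.sub contDiff_const)).mul contDiff_const) hcs.mul_right hts (u t)
      simp only [(hd _).deriv] at this
      simpa [hJ (u t)] using this
    · simp [image_eq_zero_of_notMem_tsupport ht]
  rw [integral_sub i1 i2, e2] at e1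
  simp only [mul_assoc] at e1 ⊢
  linarith

end ProductRule

/-! ### Functions with an integrable weak derivative -/

section DuBoisReymond

variable {F : Type*} [NormedAddCommGroup F] [NormedSpace ℝ F]

theorem integrableOn_smul_of_hasCompactSupport {S : Set ℝ} {w : ℝ → F} (hw : IntegrableOn w S)
    {f : ℝ → ℝ} (hf : Continuous f) (hfc : HasCompactSupport f) :
    IntegrableOn (fun t => f t • w t) S := by
  obtain ⟨C, hC⟩ := hfc.exists_bound_of_continuous hf
  exact Integrable.bdd_smul hw C hf.aestronglyMeasurable (ae_of_all _ hC)

theorem exists_Ioo_of_isCompact_subset_Ioo {T : ℝ} (hT : 0 < T) {K : Set ℝ} (hK : IsCompact K)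
    (hKT : K ⊆ Ioo 0 T) : ∃ a b, 0 < a ∧ b < T ∧ K ⊆ Ioo a b := by
  rcases K.eq_empty_or_nonempty with rfl | hne
  · exact ⟨T / 2, T / 2, by linarith, by linarith, empty_subset _⟩
  · obtain ⟨a, ha, ha'⟩ := hK.exists_isLeast hne
    obtain ⟨b, hb, hb'⟩ := hK.exists_isGreatest hne
    have h1 := (hKT ha).1
    have h2 := (hKT hb).2
    exact ⟨a / 2, (b + T) / 2, by linarith, by linarith,
      fun x hx => ⟨by linarith [ha' hx], by linarith [hb' hx]⟩⟩

theorem integral_deriv_smul_primitive [CompleteSpace F] {T : ℝ} {G : ℝ → F}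
    (hG : IntegrableOn G (Ioo 0 T)) {φ : ℝ → ℝ} (hφ : ContDiff ℝ ∞ φ)
    (hφc : HasCompactSupport φ) (hφT : tsupport φ ⊆ Ioo 0 T) :
    ∫ t in Ioo 0 T, deriv φ t • (∫ s in (0 : ℝ)..t, G s) = - ∫ t in Ioo 0 T, φ t • G t := by
  have hφ' : ContDiff ℝ ∞ (deriv φ) := (contDiff_infty_iff_deriv.1 hφ).2
  set μ := (volume : Measure ℝ).restrict (Ioo 0 T) with hμ
  have hT0 : φ T = 0 := image_eq_zero_of_notMem_tsupport fun h => (hφT h).2.false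
  have hdI : Integrable (deriv φ) μ :=
    (hφ'.continuous.integrable_of_hasCompactSupport hφc.deriv).restrict
  have hm : MeasurableSet {z : ℝ × ℝ | z.2 < z.1} := measurableSet_lt measurable_snd measurable_fst
  have hI : Integrable ({z : ℝ × ℝ | z.2 < z.1}.indicator fun z => deriv φ z.1 • G z.2)
      (μ.prod μ) := (hdI.smul_prod hG).indicator hm
  have e1 : ∫ t in Ioo 0 T, deriv φ t • (∫ s in (0 : ℝ)..t, G s)
      = ∫ t, ∫ s, ({z : ℝ × ℝ | z.2 < z.1}.indicator fun z => deriv φ z.1 • G z.2) (t, s) ∂μ ∂μ := by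
    refine setIntegral_congr_fun measurableSet_Ioo fun t ht => ?_
    have : ∀ s, ({z : ℝ × ℝ | z.2 < z.1}.indicator fun z => deriv φ z.1 • G z.2) (t, s)
        = deriv φ t • (Iio t).indicator G s := by
      intro s
      by_cases h : s < t <;> simp [indicator, h]
    simp only [this]
    rw [integral_smul, integral_indicator measurableSet_Iio, hμ,
      Measure.restrict_restrict measurableSet_Iio, intervalIntegral.integral_of_le ht.1.le,
      integral_Ioc_eq_integral_Ioo]
    congr 3
    ext s
    simp only [mem_Ioo, mem_inter_iff, mem_Iio]
    exact ⟨fun h => ⟨h.2, h.1, h.2.trans ht.2⟩, fun h => ⟨h.2.1, h.1⟩⟩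
  rw [e1, integral_integral_swap
    (f := fun t s => ({z : ℝ × ℝ | z.2 < z.1}.indicator fun z => deriv φ z.1 • G z.2) (t, s)) hI,
    ← integral_neg]
  refine setIntegral_congr_fun measurableSet_Ioo fun s hs => ?_
  have : ∀ t, ({z : ℝ × ℝ | z.2 < z.1}.indicator fun z => deriv φ z.1 • G z.2) (t, s)
      = (Ioi s).indicator (deriv φ) t • G s := by
    intro t
    by_cases h : s < t <;> simp [indicator, h]
  simp only [this]
  rw [integral_smul_const, integral_indicator measurableSet_Ioi, hμ,
    Measure.restrict_restrict measurableSet_Ioi]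
  have hset : Ioi s ∩ Ioo 0 T = Ioo s T := by
    ext t
    simp only [mem_Ioo, mem_inter_iff, mem_Ioi]
    exact ⟨fun h => ⟨h.1, h.2.2⟩, fun h => ⟨h.1, hs.1.trans h.1, h.2⟩⟩
  rw [hset, ← integral_Ioc_eq_integral_Ioo, ← intervalIntegral.integral_of_le hs.2.le,
    intervalIntegral.integral_eq_sub_of_hasDerivAt
      (fun x _ => (hφ.differentiable (by simp) x).hasDerivAt)
      (hφ'.continuous.intervalIntegrable _ _), hT0]
  simp

theorem exists_primitive_of_integral_eq_zero {T : ℝ} (hT : 0 < T) {ψ : ℝ → ℝ}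
    (hψ : ContDiff ℝ ∞ ψ) (hψc : HasCompactSupport ψ) (hψT : tsupport ψ ⊆ Ioo 0 T)
    (h0 : ∫ t, ψ t = 0) :
    ∃ φ : ℝ → ℝ, ContDiff ℝ ∞ φ ∧ HasCompactSupport φ ∧ tsupport φ ⊆ Ioo 0 T ∧ deriv φ = ψ := by
  obtain ⟨a, b, ha, hb, hK⟩ := exists_Ioo_of_isCompact_subset_Ioo hT hψc hψT
  have hz : ∀ x, x ∉ Ioo a b → ψ x = 0 :=
    fun x hx => image_eq_zero_of_notMem_tsupport fun h => hx (hK h)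
  have hd : ∀ x, HasDerivAt (fun x => ∫ t in a..x, ψ t) (ψ x) x :=
    fun x => hψ.continuous.integral_hasStrictDerivAt a x |>.hasDerivAt
  have hd' : deriv (fun x => ∫ t in a..x, ψ t) = ψ := funext fun x => (hd x).deriv
  have hout : ∀ x, x ∉ Icc a b → ∫ t in a..x, ψ t = 0 := by
    intro x hx
    rcases lt_or_ge x a with h | h
    · refine (intervalIntegral.integral_congr (g := fun _ => (0 : ℝ)) fun t ht => ?_).trans
        intervalIntegral.integral_zero
      rw [uIcc_of_ge h.le] at ht
      exact hz t fun h' => (ht.2.trans_lt h'.1).false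
    · have hbx : b < x := lt_of_not_ge fun h' => hx ⟨h, h'⟩
      rw [intervalIntegral.integral_eq_integral_of_support_subset, h0]
      intro t ht
      have := hK (subset_tsupport ψ ht)
      exact ⟨this.1, (this.2.trans hbx).le⟩
  have hts : tsupport (fun x => ∫ t in a..x, ψ t) ⊆ Icc a b :=
    closure_minimal (fun x hx => by_contra fun h => hx (hout x h)) isClosed_Icc
  refine ⟨fun x => ∫ t in a..x, ψ t, ?_, isCompact_Icc.of_isClosed_subset (isClosed_tsupport _) hts,
    hts.trans (fun x hx => ⟨ha.trans_le hx.1, hx.2.trans_lt hb⟩), hd'⟩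
  exact contDiff_infty_iff_deriv.2 ⟨fun x => (hd x).differentiableAt, by rw [hd']; exact hψ⟩

/-- The lemma of du Bois-Reymond, for Banach-valued functions. -/
theorem ae_eq_const_of_integral_deriv_smul_eq_zero [CompleteSpace F] {T : ℝ} (hT : 0 < T)
    {w : ℝ → F} (hw : IntegrableOn w (Ioo 0 T))
    (h : ∀ φ : ℝ → ℝ, ContDiff ℝ ∞ φ → HasCompactSupport φ → tsupport φ ⊆ Ioo 0 T →
      ∫ t in Ioo 0 T, deriv φ t • w t = 0) :
    ∃ c, ∀ᵐ t ∂(volume.restrict (Ioo 0 T)), w t = c := by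
  -- A test function with integral one.
  let β : ContDiffBump (T / 2) := ⟨T / 8, T / 4, by positivity, by linarith⟩
  set ψ₀ := β.normed volume with hψ₀
  have h₀ : ContDiff ℝ ∞ ψ₀ := β.contDiff_normed
  have h₀c : HasCompactSupport ψ₀ := β.hasCompactSupport_normed
  have h₀T : tsupport ψ₀ ⊆ Ioo 0 T := by
    rw [hψ₀, β.tsupport_normed_eq]
    intro x hx
    rw [Metric.mem_closedBall, Real.dist_eq, abs_le] at hx
    change _ ≤ _ ∧ _ ≤ T / 4 at hx
    have : - (T / 4) ≤ x - T / 2 := hx.1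
    constructor <;> linarith [hx.2]
  have hset : ∀ f : ℝ → ℝ, tsupport f ⊆ Ioo 0 T → ∀ x, x ∉ Ioo 0 T → f x = 0 :=
    fun f hf x hx => image_eq_zero_of_notMem_tsupport fun h => hx (hf h)
  have hi : ∀ f : ℝ → ℝ, ContDiff ℝ ∞ f → HasCompactSupport f →
      IntegrableOn (fun t => f t • w t) (Ioo 0 T) :=
    fun f hf hfc => integrableOn_smul_of_hasCompactSupport hw hf.continuous hfc
  set c := ∫ t in Ioo 0 T, ψ₀ t • w t with hc
  refine ⟨c, ?_⟩
  have hci : IntegrableOn (fun _ : ℝ => c) (Ioo 0 T) := integrableOn_const (by simp)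
  have key : ∀ᵐ t, t ∈ Ioo 0 T → w t - c = 0 := by
    refine isOpen_Ioo.ae_eq_zero_of_integral_contDiff_smul_eq_zero
      (hw.sub hci).locallyIntegrableOn fun ψ hψ hψc hψT => ?_
    rw [← setIntegral_eq_integral_of_forall_compl_eq_zero (s := Ioo 0 T)
      (fun x hx => by rw [hset ψ hψT x hx, zero_smul])]
    -- `ψ - (∫ ψ) ψ₀` has integral zero, hence is the derivative of a test function.
    obtain ⟨φ, hφ, hφc, hφT, hd⟩ := exists_primitive_of_integral_eq_zero hT
      (ψ := ψ - (∫ t, ψ t) • ψ₀) (hψ.sub (contDiff_const.smul h₀))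
      (hψc.sub (h₀c.smul_left (f := fun _ => ∫ t, ψ t)))
      ((tsupport_sub _ _).trans (union_subset hψT
        ((tsupport_smul_subset_right (fun _ => ∫ t, ψ t) ψ₀).trans h₀T)))
      (by
        simp only [Pi.sub_apply, Pi.smul_apply]
        rw [integral_sub (hψ.continuous.integrable_of_hasCompactSupport hψc)
          (Integrable.fun_smul (∫ t, ψ t) (h₀.continuous.integrable_of_hasCompactSupport h₀c)),
          integral_smul,
          β.integral_normed]
        simp)
    have := h φ hφ hφc hφT
    simp only [hd, Pi.sub_apply, Pi.smul_apply, sub_smul, smul_assoc] at this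
    rw [integral_sub (hi ψ hψ hψc) (Integrable.fun_smul (∫ t, ψ t) (hi ψ₀ h₀ h₀c)),
      integral_smul, ← hc] at this
    simp only [smul_sub]
    rw [integral_sub (hi ψ hψ hψc)
      ((hψ.continuous.integrable_of_hasCompactSupport hψc).restrict.smul_const _),
      integral_smul_const, setIntegral_eq_integral_of_forall_compl_eq_zero (hset ψ hψT)]
    exact this
  rw [ae_restrict_iff' measurableSet_Ioo]
  filter_upwards [key] with t ht h using sub_eq_zero.1 (ht h)

theorem ae_eq_add_primitive [CompleteSpace F] {T : ℝ} (hT : 0 < T)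
    {f G : ℝ → F} (hf : IntegrableOn f (Ioo 0 T)) (hG : IntegrableOn G (Ioo 0 T))
    (h : ∀ φ : ℝ → ℝ, ContDiff ℝ ∞ φ → HasCompactSupport φ → tsupport φ ⊆ Ioo 0 T →
      ∫ t in Ioo 0 T, deriv φ t • f t = - ∫ t in Ioo 0 T, φ t • G t) :
    ∃ c, ∀ᵐ t ∂(volume.restrict (Ioo 0 T)), f t = c + ∫ s in (0 : ℝ)..t, G s := by
  have hcont : ContinuousOn (fun t => ∫ s in (0 : ℝ)..t, G s) (Icc 0 T) :=
    intervalIntegral.continuousOn_primitive_interval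
      (by rw [uIcc_of_le hT.le, integrableOn_Icc_iff_integrableOn_Ioo]; exact hG) |>.mono
      (by rw [uIcc_of_le hT.le])
  have hPi : IntegrableOn (fun t => ∫ s in (0 : ℝ)..t, G s) (Ioo 0 T) :=
    (hcont.integrableOn_compact isCompact_Icc).mono_set Ioo_subset_Icc_self
  obtain ⟨c, hc⟩ := ae_eq_const_of_integral_deriv_smul_eq_zero hT (hf.sub hPi) (by
    intro φ hφ hφc hφT
    have hφ' : ContDiff ℝ ∞ (deriv φ) := (contDiff_infty_iff_deriv.1 hφ).2
    simp only [Pi.sub_apply, smul_sub]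
    rw [integral_sub (integrableOn_smul_of_hasCompactSupport hf hφ'.continuous hφc.deriv)
      (integrableOn_smul_of_hasCompactSupport hPi hφ'.continuous hφc.deriv),
      h φ hφ hφc hφT, integral_deriv_smul_primitive hG hφ hφc hφT, sub_self])
  refine ⟨c, ?_⟩
  filter_upwards [hc] with t ht
  rw [← ht]
  simp

end DuBoisReymond

/-! ### The space `V` and its pairings -/

section Pairings

variable {d m : ℕ} {Ω : Set (E d)} {p p' : ℝ≥0∞} [Fact (1 ≤ p)] [Fact (1 ≤ p')]

/-- The inclusion `V → W_0^{1,p}` as a continuous linear map. -/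
def V.sobL : V Ω m p p' →L[ℝ] W01 Ω m p :=
  (ContinuousLinearMap.fst ℝ (W01 Ω m p) (LSp Ω (E m) p')).comp (interSubmodule Ω m p p').subtypeL

/-- The inclusion `V → L^{p'}` as a continuous linear map. -/
def V.fnL : V Ω m p p' →L[ℝ] LSp Ω (E m) p' :=
  (ContinuousLinearMap.snd ℝ (W01 Ω m p) (LSp Ω (E m) p')).comp (interSubmodule Ω m p p').subtypeL

theorem V.norm_eq (z : V Ω m p p') : ‖z‖ = max ‖z.sob‖ ‖z.fn‖ := rfl

theorem V.fn_sob_ae (z : V Ω m p p') : z.sob.fn =ᵐ[volume.restrict Ω] z.fn := z.2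

theorem V.ext_sob {z y : V Ω m p p'} (h : z.sob = y.sob) : z = y := by
  refine Subtype.ext (Prod.ext h (Lp.ext ?_))
  have h1 := V.fn_sob_ae z
  rw [h] at h1
  exact h1.symm.trans (V.fn_sob_ae y)

theorem W01.norm_fn_le (w : W01 Ω m p) : ‖w.fn‖ ≤ ‖w‖ := le_max_left _ _

/-- The inclusion `L^p ⊆ L^q`, `q ≤ p`, over a finite measure. -/
def lpInclusion {α X : Type*} [MeasurableSpace α] (μ : Measure α) [IsFiniteMeasure μ]
    [NormedAddCommGroup X] [NormedSpace ℝ X] {p q : ℝ≥0∞} [Fact (1 ≤ p)] [Fact (1 ≤ q)]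
    (hqp : q ≤ p) : Lp X p μ →L[ℝ] Lp X q μ :=
  LinearMap.mkContinuousOfExistsBound
    { toFun := fun f => ((Lp.memLp f).mono_exponent hqp).toLp f
      map_add' := fun f g => by
        rw [← MemLp.toLp_add]
        exact MemLp.toLp_congr _ _ (Lp.coeFn_add f g)
      map_smul' := fun c f => by
        rw [RingHom.id_apply, ← MemLp.toLp_const_smul]
        exact MemLp.toLp_congr _ _ (Lp.coeFn_smul c f) }
    (by
      refine ⟨(μ univ ^ (1 / q.toReal - 1 / p.toReal)).toReal, fun f => ?_⟩
      change ‖((Lp.memLp f).mono_exponent hqp).toLp f‖ ≤ _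
      rw [Lp.norm_toLp, Lp.norm_def, mul_comm, ← ENNReal.toReal_mul]
      refine ENNReal.toReal_mono (ENNReal.mul_ne_top (Lp.eLpNorm_ne_top f) ?_)
        (eLpNorm_le_eLpNorm_mul_rpow_measure_univ hqp (Lp.aestronglyMeasurable f))
      have hq1 : (1 : ℝ≥0∞) ≤ q := Fact.out
      refine ENNReal.rpow_ne_top_of_nonneg (sub_nonneg.2 ?_) (measure_ne_top μ _)
      rcases eq_or_ne p ⊤ with rfl | hp
      · simp
      · have hq : q ≠ ⊤ := ne_top_of_le_ne_top hp hqp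
        exact one_div_le_one_div_of_le (ENNReal.toReal_pos (by positivity) hq)
          (ENNReal.toReal_mono hp hqp))

theorem coeFn_lpInclusion {α X : Type*} [MeasurableSpace α] (μ : Measure α) [IsFiniteMeasure μ]
    [NormedAddCommGroup X] [NormedSpace ℝ X] {p q : ℝ≥0∞} [Fact (1 ≤ p)] [Fact (1 ≤ q)]
    (hqp : q ≤ p) (f : Lp X p μ) : lpInclusion μ hqp f =ᵐ[μ] f :=
  MemLp.coeFn_toLp ((Lp.memLp f).mono_exponent hqp)

/-- The inclusion `V → L²`, for `Ω` of finite measure and `p' ≥ 2`. -/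
def V.l2 [IsFiniteMeasure (volume.restrict Ω)] (h2 : 2 ≤ p') : V Ω m p p' →L[ℝ] LSp Ω (E m) 2 :=
  (lpInclusion (volume.restrict Ω) h2).comp V.fnL

theorem V.coeFn_l2 [IsFiniteMeasure (volume.restrict Ω)] (h2 : 2 ≤ p') (z : V Ω m p p') :
    V.l2 h2 z =ᵐ[volume.restrict Ω] z.fn :=
  coeFn_lpInclusion _ h2 z.fn

/-- The embedding `V → V'` given by the `L²`-product. -/
def V.toDual [IsFiniteMeasure (volume.restrict Ω)] (h2 : 2 ≤ p') :
    V Ω m p p' →L[ℝ] StrongDual ℝ (V Ω m p p') :=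
  (innerSL ℝ).bilinearComp (V.l2 h2) (V.l2 h2)

theorem V.toDual_apply [IsFiniteMeasure (volume.restrict Ω)] (h2 : 2 ≤ p') (z y : V Ω m p p') :
    V.toDual h2 z y = inner ℝ (V.l2 h2 z) (V.l2 h2 y) := rfl

theorem V.toDual_eq_integral [IsFiniteMeasure (volume.restrict Ω)] (h2 : 2 ≤ p')
    (z y : V Ω m p p') : V.toDual h2 z y = ∫ x in Ω, inner ℝ (z.fn x) (y.fn x) := by
  rw [V.toDual_apply, L2.inner_def]
  refine integral_congr_ae ?_
  filter_upwards [V.coeFn_l2 h2 z, V.coeFn_l2 h2 y] with x h1 h2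
  rw [h1, h2]

theorem V.toDual_comm [IsFiniteMeasure (volume.restrict Ω)] (h2 : 2 ≤ p')
    (z y : V Ω m p p') : V.toDual h2 z y = V.toDual h2 y z :=
  (V.toDual_apply h2 z y).trans (real_inner_comm _ _)

variable (Ω m p p') in
/-- The duality pairing `(f, z) = ∫ f · z dx` of `L^p` and `L^{p'}`. -/
def dualPairing [ENNReal.HolderConjugate p p'] :
    LSp Ω (E m) p →L[ℝ] LSp Ω (E m) p' →L[ℝ] ℝ :=
  (innerSL ℝ).lpPairing (volume.restrict Ω) p p'

theorem dualPairing_apply [ENNReal.HolderConjugate p p'] (f : LSp Ω (E m) p)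
    (z : LSp Ω (E m) p') : dualPairing m Ω p p' f z = ∫ x in Ω, inner ℝ (f x) (z x) :=
  ContinuousLinearMap.lpPairing_eq_integral _ _ _

/-- Interpolation of `L^q` between `L^p` and `L^∞`. -/
theorem eLpNorm_le_of_ae_bound_of_eLpNorm {α X : Type*} [MeasurableSpace α] {μ : Measure α}
    [NormedAddCommGroup X] {p q : ℝ≥0∞} (hp0 : p ≠ 0) (hq : q ≠ ⊤) (hpq : p ≤ q) {f : α → X}
    {B : ℝ≥0∞} (hBt : B ≠ ⊤) (hB : ∀ᵐ x ∂μ, ‖f x‖ₑ ≤ B) :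
    eLpNorm f q μ ≤ B ^ ((q.toReal - p.toReal) / q.toReal)
      * eLpNorm f p μ ^ (p.toReal / q.toReal) := by
  have hp : p ≠ ⊤ := ne_top_of_le_ne_top hq hpq
  have hq0 : q ≠ 0 := fun h => hp0 (le_zero_iff.1 (h ▸ hpq))
  have h1 : 0 < p.toReal := ENNReal.toReal_pos hp0 hp
  have h2 : 0 < q.toReal := ENNReal.toReal_pos hq0 hq
  have h3 : p.toReal ≤ q.toReal := ENNReal.toReal_mono hq hpq
  rw [eLpNorm_eq_lintegral_rpow_enorm_toReal hq0 hq, eLpNorm_eq_lintegral_rpow_enorm_toReal hp0 hp]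
  have h4 : ∫⁻ x, ‖f x‖ₑ ^ q.toReal ∂μ
      ≤ B ^ (q.toReal - p.toReal) * ∫⁻ x, ‖f x‖ₑ ^ p.toReal ∂μ := by
    rw [← lintegral_const_mul' _ _ (ENNReal.rpow_ne_top_of_nonneg (sub_nonneg.2 h3) hBt)]
    refine lintegral_mono_ae (hB.mono fun x hx => ?_)
    calc ‖f x‖ₑ ^ q.toReal = ‖f x‖ₑ ^ (q.toReal - p.toReal) * ‖f x‖ₑ ^ p.toReal := by
          rw [← ENNReal.rpow_add_of_nonneg _ _ (sub_nonneg.2 h3) h1.le, sub_add_cancel]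
      _ ≤ _ := by
          gcongr
  calc _ ≤ (B ^ (q.toReal - p.toReal) * ∫⁻ x, ‖f x‖ₑ ^ p.toReal ∂μ) ^ (1 / q.toReal) := by gcongr
    _ = _ := by
      rw [ENNReal.mul_rpow_of_nonneg _ _ (by positivity), ← ENNReal.rpow_mul, ← ENNReal.rpow_mul]
      congr 2
      · ring
      · field_simp

/-- On a set of functions that are bounded by a common constant, the norm of `V` defines the same
uniformity as the norm of `W_0^{1,p}`. -/
theorem V.isUniformInducing_sob_of_bound (hp' : p' ≠ ⊤) (hpp : p ≤ p') (M : ℝ) :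
    IsUniformInducing fun z : {z : V Ω m p p' // ∀ᵐ x ∂volume.restrict Ω, ‖z.fn x‖ ≤ M} =>
      z.1.sob := by
  have hp0 : p ≠ 0 := (zero_lt_one.trans_le (Fact.out : 1 ≤ p)).ne'
  have hp : p ≠ ⊤ := ne_top_of_le_ne_top hp' hpp
  have hθ : 0 < p.toReal / p'.toReal :=
    div_pos (ENNReal.toReal_pos hp0 hp)
      (ENNReal.toReal_pos (fun h => hp0 (le_zero_iff.1 (h ▸ hpp))) hp')
  set θ := p.toReal / p'.toReal
  set C : ℝ≥0∞ := ENNReal.ofReal (2 * M) ^ ((p'.toReal - p.toReal) / p'.toReal) with hC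
  have hCt : C ≠ ⊤ := ENNReal.rpow_ne_top_of_nonneg
    (div_nonneg (sub_nonneg.2 (ENNReal.toReal_mono hp' hpp)) ENNReal.toReal_nonneg)
    ENNReal.ofReal_ne_top
  -- The Hölder bound of the `L^{p'}`-distance by the `L^p`-distance.
  have key : ∀ z y : {z : V Ω m p p' // ∀ᵐ x ∂volume.restrict Ω, ‖z.fn x‖ ≤ M},
      ‖z.1.fn - y.1.fn‖ ≤ C.toReal * dist z.1.sob y.1.sob ^ θ := by
    intro z y
    have hsub : (z.1 - y.1).fn = z.1.fn - y.1.fn := map_sub V.fnL z.1 y.1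
    have hsub' : (z.1 - y.1).sob = z.1.sob - y.1.sob := map_sub V.sobL z.1 y.1
    have hb : ∀ᵐ x ∂volume.restrict Ω, ‖(z.1.fn - y.1.fn) x‖ₑ ≤ ENNReal.ofReal (2 * M) := by
      filter_upwards [z.2, y.2, Lp.coeFn_sub z.1.fn y.1.fn] with x h1 h2 h3
      rw [h3, Pi.sub_apply, ← ofReal_norm]
      exact ENNReal.ofReal_le_ofReal ((norm_sub_le _ _).trans (by linarith))
    have h1 := eLpNorm_le_of_ae_bound_of_eLpNorm hp0 hp' hpp ENNReal.ofReal_ne_top hb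
    have h2 : eLpNorm (z.1.fn - y.1.fn : LSp Ω (E m) p') p (volume.restrict Ω)
        = eLpNorm (z.1 - y.1).sob.fn p (volume.restrict Ω) := by
      rw [← hsub]
      exact (eLpNorm_congr_ae (V.fn_sob_ae _)).symm
    rw [h2] at h1
    have h3 : ‖(z.1 - y.1).sob.fn‖ ≤ dist z.1.sob y.1.sob := by
      rw [dist_eq_norm, ← hsub']
      exact W01.norm_fn_le _
    calc ‖z.1.fn - y.1.fn‖ ≤ C.toReal * ‖(z.1 - y.1).sob.fn‖ ^ θ := by
          rw [Lp.norm_def, Lp.norm_def, ENNReal.toReal_rpow, ← ENNReal.toReal_mul]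
          exact ENNReal.toReal_mono (ENNReal.mul_ne_top hCt
            (ENNReal.rpow_ne_top_of_nonneg hθ.le (Lp.eLpNorm_ne_top _))) h1
      _ ≤ _ := by gcongr
  rw [Metric.isUniformInducing_iff]
  refine ⟨(V.sobL (Ω := Ω) (m := m) (p := p) (p' := p')).uniformContinuous.comp
    uniformContinuous_subtype_val, fun δ hδ => ?_⟩
  have hlim : Tendsto (fun r : ℝ => C.toReal * r ^ θ) (𝓝 0) (𝓝 0) := by
    have := (Real.continuousAt_rpow_const 0 θ (Or.inr hθ.le)).const_mul C.toReal |>.tendsto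
    simpa [Real.zero_rpow hθ.ne'] using this
  obtain ⟨ε, hε, h⟩ := Metric.eventually_nhds_iff.1 (hlim.eventually (gt_mem_nhds hδ))
  refine ⟨min ε δ, lt_min hε hδ, fun {z y} hzy => ?_⟩
  rw [Subtype.dist_eq, dist_eq_norm, V.norm_eq]
  have hsub : (z.1 - y.1).fn = z.1.fn - y.1.fn := map_sub V.fnL z.1 y.1
  have hsub' : (z.1 - y.1).sob = z.1.sob - y.1.sob := map_sub V.sobL z.1 y.1
  refine max_lt ?_ ?_
  · rw [hsub', ← dist_eq_norm]
    exact hzy.trans_le (min_le_right _ _)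
  · rw [hsub]
    refine (key z y).trans_lt (h ?_)
    rw [Real.dist_eq, sub_zero, abs_of_nonneg dist_nonneg]
    exact hzy.trans_le (min_le_left _ _)

/-- A uniformly bounded function that is measurable into `W_0^{1,p}` is measurable into `V`. -/
theorem aestronglyMeasurable_of_sob {α : Type*} [MeasurableSpace α] {μ : Measure α}
    (hp' : p' ≠ ⊤) (hpp : p ≤ p') {u : α → V Ω m p p'}
    (hu : AEStronglyMeasurable (fun t => (u t).sob) μ) {M : ℝ} (hM : 0 ≤ M)
    (hb : ∀ᵐ t ∂μ, ∀ᵐ x ∂volume.restrict Ω, ‖(u t).fn x‖ ≤ M) :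
    AEStronglyMeasurable u μ := by
  classical
  have hz : ∀ᵐ x ∂volume.restrict Ω, ‖(0 : V Ω m p p').fn x‖ ≤ M := by
    have h0 : (0 : V Ω m p p').fn = 0 := rfl
    rw [h0]
    filter_upwards [Lp.coeFn_zero (E m) p' (volume.restrict Ω)] with x hx
    rw [hx]
    simpa using hM
  let w : α → {z : V Ω m p p' // ∀ᵐ x ∂volume.restrict Ω, ‖z.fn x‖ ≤ M} := fun t =>
    if h : ∀ᵐ x ∂volume.restrict Ω, ‖(u t).fn x‖ ≤ M then ⟨u t, h⟩ else ⟨0, hz⟩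
  have hw : ∀ᵐ t ∂μ, (w t).1 = u t := hb.mono fun t ht => by simp [w, ht]
  have hemb : Topology.IsEmbedding fun z : {z : V Ω m p p' //
      ∀ᵐ x ∂volume.restrict Ω, ‖z.fn x‖ ≤ M} => z.1.sob :=
    ⟨(V.isUniformInducing_sob_of_bound hp' hpp M).isInducing,
      fun z y h => Subtype.ext (V.ext_sob h)⟩
  have hws : AEStronglyMeasurable (fun t => (w t).1.sob) μ :=
    hu.congr (hw.mono fun t ht => by simp only [ht])
  have hwm : AEStronglyMeasurable w μ := hemb.aestronglyMeasurable_comp_iff.1 hws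
  exact (continuous_subtype_val.comp_aestronglyMeasurable hwm).congr hw

end Pairings

/-! ### Regularity of the functions in `W` -/

section Evolution

variable {d m : ℕ} {Ω : Set (E d)} {p p' : ℝ≥0∞} [Fact (1 ≤ p)] [Fact (1 ≤ p')]

/-- The time derivative is unique. -/
theorem IsTimeDeriv.ae_eq {T : ℝ} {u : ℝ → V Ω m p p'} {F G : ℝ → StrongDual ℝ (V Ω m p p')}
    (hF : IsTimeDeriv T u F) (hG : IsTimeDeriv T u G) :
    F =ᵐ[volume.restrict (Ioo 0 T)] G := by
  have key : ∀ᵐ t, t ∈ Ioo 0 T → F t - G t = 0 := by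
    refine isOpen_Ioo.ae_eq_zero_of_integral_contDiff_smul_eq_zero
      (hF.integrable.sub hG.integrable).locallyIntegrableOn fun φ hφ hφc hφT => ?_
    rw [← setIntegral_eq_integral_of_forall_compl_eq_zero (s := Ioo 0 T) (fun x hx => by
      rw [image_eq_zero_of_notMem_tsupport fun h => hx (hφT h), zero_smul])]
    have iF := integrableOn_smul_of_hasCompactSupport hF.integrable hφ.continuous hφc
    have iG := integrableOn_smul_of_hasCompactSupport hG.integrable hφ.continuous hφc
    simp only [smul_sub]
    rw [integral_sub iF iG, sub_eq_zero]
    ext z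
    rw [ContinuousLinearMap.integral_apply iF, ContinuousLinearMap.integral_apply iG]
    have h1 := hF.eq φ hφ hφc hφT z
    rw [hG.eq φ hφ hφc hφT z] at h1
    simpa using h1.symm
  rw [Filter.EventuallyEq, ae_restrict_iff' measurableSet_Ioo]
  filter_upwards [key] with t ht h using sub_eq_zero.1 (ht h)

theorem IsContRep.ae_eq_l2 [IsFiniteMeasure (volume.restrict Ω)] (h2 : 2 ≤ p') {T : ℝ}
    {u : ℝ → V Ω m p p'} {c : ℝ → LSp Ω (E m) 2} (hc : IsContRep T u c) :
    ∀ᵐ t ∂volume.restrict (Ioo 0 T), c t = V.l2 h2 (u t) :=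
  hc.ae_eq.mono fun t ht => Lp.ext (ht.trans (V.coeFn_l2 h2 (u t)).symm)

/-- The regularity of `u ∈ W` and of its time derivative `u'` that the integration by parts uses:
`u` is bounded in `L^{p'}` and in `L^p(0,T; W_0^{1,p})`, and `u' = f + g` with
`f ∈ L^p(0,T; L^p)` and `g ∈ L^{p'}(0,T; W^{-1,p'})`. -/
structure IsRegular [ENNReal.HolderConjugate p p'] (T : ℝ) (u : ℝ → V Ω m p p')
    (u' : ℝ → StrongDual ℝ (V Ω m p p')) : Prop where
  aestronglyMeasurable : AEStronglyMeasurable u (volume.restrict (Ioo 0 T))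
  memLp_sob : MemLp (fun t => (u t).sob) p (volume.restrict (Ioo 0 T))
  bound : ∃ M, ∀ᵐ t ∂volume.restrict (Ioo 0 T), ‖(u t).fn‖ ≤ M
  split : ∃ (f : ℝ → LSp Ω (E m) p) (g : ℝ → StrongDual ℝ (W01 Ω m p)),
    MemLp f p (volume.restrict (Ioo 0 T)) ∧ MemLp g p' (volume.restrict (Ioo 0 T)) ∧
    ∀ᵐ t ∂volume.restrict (Ioo 0 T), ∀ z : V Ω m p p',
      u' t z = dualPairing m Ω p p' (f t) z.fn + g t z.sob
  isTimeDeriv : IsTimeDeriv T u u'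

theorem MemW.isRegular [ENNReal.HolderConjugate p p'] [IsFiniteMeasure (volume.restrict Ω)]
    (hp' : p' ≠ ⊤) (hpp : p ≤ p') {T : ℝ} {u : ℝ → V Ω m p p'} (hu : MemW T u)
    {u' : ℝ → StrongDual ℝ (V Ω m p p')} (hu' : IsTimeDeriv T u u') : IsRegular T u u' := by
  obtain ⟨U, hU, hUu⟩ := hu.memLp_top
  obtain ⟨F, ⟨f, g, hf, hg, hfg⟩, hF⟩ := hu.deriv
  set M := (eLpNorm U ⊤ (volume.restrict (Ioo 0 T ×ˢ Ω))).toReal with hM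
  have hUM : ∀ᵐ z ∂volume.restrict (Ioo 0 T ×ˢ Ω), ‖U z‖ ≤ M := by
    filter_upwards [ae_le_eLpNormEssSup (f := U)] with z hz
    rw [← eLpNorm_exponent_top] at hz
    rw [hM, ← toReal_enorm]
    exact ENNReal.toReal_mono hU.2.ne hz
  rw [Measure.volume_eq_prod, ← Measure.prod_restrict] at hUM
  have hb : ∀ᵐ t ∂volume.restrict (Ioo 0 T), ∀ᵐ x ∂volume.restrict Ω, ‖(u t).fn x‖ ≤ M := by
    filter_upwards [Measure.ae_ae_of_ae_prod hUM, hUu] with t h1 h2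
    filter_upwards [h1, h2] with x h3 h4
    rwa [h4]
  have hM0 : 0 ≤ M := ENNReal.toReal_nonneg
  refine ⟨aestronglyMeasurable_of_sob hp' hpp hu.memLp_sob.1 hM0 hb, hu.memLp_sob,
    ⟨_, hb.mono fun t ht => Lp.norm_le_of_ae_bound hM0 ht⟩, ⟨f, g, hf, hg, ?_⟩, hu'⟩
  filter_upwards [hfg, hu'.ae_eq hF] with t h1 h2 z
  rw [h2, h1, dualPairing_apply]

variable [ENNReal.HolderConjugate p p'] {T : ℝ} {u v : ℝ → V Ω m p p'}
  {u' v' : ℝ → StrongDual ℝ (V Ω m p p')}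

theorem IsRegular.aestronglyMeasurable_fn (hu : IsRegular T u u') :
    AEStronglyMeasurable (fun t => (u t).fn) (volume.restrict (Ioo 0 T)) :=
  V.fnL.continuous.comp_aestronglyMeasurable hu.aestronglyMeasurable

theorem IsRegular.memLp_fn (hu : IsRegular T u u') (q : ℝ≥0∞) :
    MemLp (fun t => (u t).fn) q (volume.restrict (Ioo 0 T)) :=
  hu.bound.elim fun M hM => MemLp.of_bound hu.aestronglyMeasurable_fn M hM

theorem IsRegular.integrable (hu : IsRegular T u u') : IntegrableOn u (Ioo 0 T) := by
  refine Integrable.mono' ((hu.memLp_sob.integrable Fact.out).norm.add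
    ((hu.memLp_fn 1).integrable le_rfl).norm) hu.aestronglyMeasurable (ae_of_all _ fun t => ?_)
  rw [V.norm_eq]
  exact max_le_add_of_nonneg (norm_nonneg _) (norm_nonneg _)

theorem IsRegular.integrable_apply (hu : IsRegular T u u') (hv : IsRegular T v v') :
    IntegrableOn (fun t => v' t (u t)) (Ioo 0 T) := by
  obtain ⟨f, g, hf, hg, hfg⟩ := hv.split
  have h1 : Integrable (fun t => dualPairing m Ω p p' (f t) (u t).fn)
      (volume.restrict (Ioo 0 T)) :=
    memLp_one_iff_integrable.1 ((dualPairing m Ω p p').memLp_of_bilin 1 hf (hu.memLp_fn p'))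
  have : ENNReal.HolderConjugate p' p := ENNReal.HolderConjugate.symm
  have h2 : Integrable (fun t => g t (u t).sob) (volume.restrict (Ioo 0 T)) :=
    memLp_one_iff_integrable.1
      ((ContinuousLinearMap.id ℝ (StrongDual ℝ (W01 Ω m p))).memLp_of_bilin 1 hg hu.memLp_sob)
  exact (h1.add h2).congr (hfg.mono fun t ht => (ht (u t)).symm)

end Evolution

/-! ### The product rule for functions in `W` -/

section Evolution

variable {d m : ℕ} {Ω : Set (E d)} {p p' : ℝ≥0∞} [Fact (1 ≤ p)] [Fact (1 ≤ p')]
  [ENNReal.HolderConjugate p p'] {T : ℝ}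

theorem memLp_smul_of_hasCompactSupport {X : Type*} [NormedAddCommGroup X] [NormedSpace ℝ X]
    {a : ℝ → X} {q : ℝ≥0∞} {μ : Measure ℝ} (ha : MemLp a q μ) {f : ℝ → ℝ} (hf : Continuous f)
    (hfc : HasCompactSupport f) : MemLp (fun t => f t • a t) q μ := by
  obtain ⟨C, hC⟩ := hfc.exists_bound_of_continuous hf
  exact ha.smul (memLp_top_of_bound hf.aestronglyMeasurable C (ae_of_all _ hC))

/-- The mollified duality pairing converges, because each of the two parts of `F` is paired by
Hölder's inequality: `f` with the values of `w` in `L^{p'}`, and `g` with those in `W_0^{1,p}`. -/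
theorem tendsto_mollified_duality (hp : p ≠ ⊤) (hp' : p' ≠ ⊤)
    {F : ℝ → StrongDual ℝ (V Ω m p p')} {w : ℝ → V Ω m p p'}
    {f : ℝ → LSp Ω (E m) p} {g : ℝ → StrongDual ℝ (W01 Ω m p)}
    (hf : MemLp f p (volume.restrict (Ioo 0 T))) (hg : MemLp g p' (volume.restrict (Ioo 0 T)))
    (hF : ∀ᵐ t ∂volume.restrict (Ioo 0 T), ∀ z : V Ω m p p',
      F t z = dualPairing m Ω p p' (f t) z.fn + g t z.sob)
    (hw : MemLp (fun t => (w t).sob) p (volume.restrict (Ioo 0 T)))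
    (hw' : MemLp (fun t => (w t).fn) p' (volume.restrict (Ioo 0 T)))
    {ρ : ℕ → ContDiffBump (0 : ℝ)} (hρ : Tendsto (fun n => (ρ n).rOut) atTop (𝓝 0)) :
    Tendsto (fun n => ∫ z : ℝ × ℝ, (ρ n).normed volume (z.2 - z.1) * F z.1 (w z.2)
      ∂((volume.restrict (Ioo 0 T)).prod (volume.restrict (Ioo 0 T)))) atTop
      (𝓝 (∫ t in Ioo 0 T, F t (w t))) := by
  have : ENNReal.HolderConjugate p' p := ENNReal.HolderConjugate.symm
  let D := ContinuousLinearMap.id ℝ (StrongDual ℝ (W01 Ω m p))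
  have t1 := tendsto_mollified_pairing_restrict (dualPairing m Ω p p') hp' measurableSet_Ioo
    hf hw' hρ
  have t2 := tendsto_mollified_pairing_restrict D hp measurableSet_Ioo hg hw hρ
  have i1 : IntegrableOn (fun t => dualPairing m Ω p p' (f t) (w t).fn) (Ioo 0 T) :=
    memLp_one_iff_integrable.1 ((dualPairing m Ω p p').memLp_of_bilin 1 hf hw')
  have i2 : IntegrableOn (fun t => D (g t) (w t).sob) (Ioo 0 T) :=
    memLp_one_iff_integrable.1 (D.memLp_of_bilin 1 hg hw)
  have hlim : ∫ t in Ioo 0 T, F t (w t)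
      = (∫ t in Ioo 0 T, dualPairing m Ω p p' (f t) (w t).fn)
        + ∫ t in Ioo 0 T, D (g t) (w t).sob := by
    rw [← integral_add i1 i2]
    exact integral_congr_ae (hF.mono fun t ht => ht (w t))
  rw [hlim]
  refine (t1.add t2).congr fun n => ?_
  obtain ⟨C, hC⟩ := exists_bound_normed (ρ n)
  have hc : Continuous fun z : ℝ × ℝ => (ρ n).normed volume (z.2 - z.1) :=
    ((ρ n).contDiff_normed (n := 0)).continuous.comp (by fun_prop)
  rw [← integral_add
    (integrable_prod_bilin _ (hf.integrable Fact.out) (hw'.integrable Fact.out) hc fun z => hC _)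
    (integrable_prod_bilin _ (hg.integrable Fact.out) (hw.integrable Fact.out) hc fun z => hC _)]
  refine integral_congr_ae ?_
  filter_upwards [Measure.quasiMeasurePreserving_fst.ae hF] with z hz
  rw [hz, mul_add]
  rfl

/-- The variant of `tendsto_mollified_duality` in which `F` and `w` exchange their variables. -/
theorem tendsto_mollified_duality_swap (hp : p ≠ ⊤) (hp' : p' ≠ ⊤)
    {F : ℝ → StrongDual ℝ (V Ω m p p')} {w : ℝ → V Ω m p p'}
    {f : ℝ → LSp Ω (E m) p} {g : ℝ → StrongDual ℝ (W01 Ω m p)}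
    (hf : MemLp f p (volume.restrict (Ioo 0 T))) (hg : MemLp g p' (volume.restrict (Ioo 0 T)))
    (hF : ∀ᵐ t ∂volume.restrict (Ioo 0 T), ∀ z : V Ω m p p',
      F t z = dualPairing m Ω p p' (f t) z.fn + g t z.sob)
    (hw : MemLp (fun t => (w t).sob) p (volume.restrict (Ioo 0 T)))
    (hw' : MemLp (fun t => (w t).fn) p' (volume.restrict (Ioo 0 T)))
    {ρ : ℕ → ContDiffBump (0 : ℝ)} (hρ : Tendsto (fun n => (ρ n).rOut) atTop (𝓝 0)) :
    Tendsto (fun n => ∫ z : ℝ × ℝ, (ρ n).normed volume (z.2 - z.1) * F z.2 (w z.1)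
      ∂((volume.restrict (Ioo 0 T)).prod (volume.restrict (Ioo 0 T)))) atTop
      (𝓝 (∫ t in Ioo 0 T, F t (w t))) := by
  refine (tendsto_mollified_duality hp hp' hf hg hF hw hw' hρ).congr fun n => ?_
  rw [← integral_prod_swap]
  refine integral_congr_ae (ae_of_all _ fun z => ?_)
  change (ρ n).normed volume (z.1 - z.2) * _ = _
  rw [← (ρ n).normed_neg, neg_sub]
  rfl

variable {u v : ℝ → V Ω m p p'} {u' v' : ℝ → StrongDual ℝ (V Ω m p p')}

theorem IsRegular.memLp_l2 [IsFiniteMeasure (volume.restrict Ω)] (h2 : 2 ≤ p')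
    (hu : IsRegular T u u') (q : ℝ≥0∞) :
    MemLp (fun t => V.l2 h2 (u t)) q (volume.restrict (Ioo 0 T)) :=
  (lpInclusion (X := E m) (volume.restrict Ω) h2).comp_memLp' (hu.memLp_fn q)

theorem IsRegular.integral_deriv_mul_toDual [IsFiniteMeasure (volume.restrict Ω)] (h2 : 2 ≤ p')
    (hu : IsRegular T u u') {φ : ℝ → ℝ} (hφ : ContDiff ℝ ∞ φ) (hφc : HasCompactSupport φ)
    (hφT : tsupport φ ⊆ Ioo 0 T) (z : V Ω m p p') :
    ∫ t in Ioo 0 T, deriv φ t * V.toDual h2 (u t) z = - ∫ t in Ioo 0 T, φ t * u' t z := by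
  simp only [V.toDual_eq_integral, hu.isTimeDeriv.eq φ hφ hφc hφT z]

/-- The identity `d/dt (u, v) = ⟨u', v⟩ + ⟨v', u⟩` in the sense of distributions. -/
theorem IsRegular.weak_product_rule [IsFiniteMeasure (volume.restrict Ω)] (h2 : 2 ≤ p')
    (hp : p ≠ ⊤) (hp' : p' ≠ ⊤) (hT : 0 < T)
    (hu : IsRegular T u u') (hv : IsRegular T v v') {φ : ℝ → ℝ} (hφ : ContDiff ℝ ∞ φ)
    (hφc : HasCompactSupport φ) (hφT : tsupport φ ⊆ Ioo 0 T) :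
    ∫ t in Ioo 0 T, deriv φ t * V.toDual h2 (u t) (v t)
      = - ∫ t in Ioo 0 T, φ t * (u' t (v t) + v' t (u t)) := by
  have hφ' : ContDiff ℝ ∞ (deriv φ) := (contDiff_infty_iff_deriv.1 hφ).2
  let ρ : ℕ → ContDiffBump (0 : ℝ) := fun n =>
    ⟨1 / (n + 1) / 2, 1 / (n + 1), by positivity, half_lt_self (by positivity)⟩
  have hρ : Tendsto (fun n => (ρ n).rOut) atTop (𝓝 0) := tendsto_one_div_add_atTop_nhds_zero_nat
  obtain ⟨f, g, hf, hg, hfg⟩ := hu.split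
  obtain ⟨k, l, hk, hl, hkl⟩ := hv.split
  obtain ⟨a, b, ha, hb, hab⟩ := exists_Ioo_of_isCompact_subset_Ioo hT hφc hφT
  -- The limits of the three terms of the mollified product rule.
  have tA : Tendsto (fun n => ∫ z : ℝ × ℝ, (ρ n).normed volume (z.2 - z.1) *
      (deriv φ z.1 * V.toDual h2 (u z.1) (v z.2))
      ∂((volume.restrict (Ioo 0 T)).prod (volume.restrict (Ioo 0 T)))) atTop
      (𝓝 (∫ t in Ioo 0 T, deriv φ t * V.toDual h2 (u t) (v t))) := by
    have := tendsto_mollified_pairing_restrict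
      (innerSL ℝ : LSp Ω (E m) 2 →L[ℝ] LSp Ω (E m) 2 →L[ℝ] ℝ) hp' measurableSet_Ioo
      (memLp_smul_of_hasCompactSupport (hu.memLp_l2 h2 p) hφ'.continuous hφc.deriv)
      (hv.memLp_l2 h2 p') hρ
    have e : ∀ x y : V Ω m p p', V.toDual h2 x y
      = (innerSL ℝ : LSp Ω (E m) 2 →L[ℝ] LSp Ω (E m) 2 →L[ℝ] ℝ) (V.l2 h2 x) (V.l2 h2 y) :=
      fun _ _ => rfl
    simpa only [e, map_smul, smul_apply, smul_eq_mul] using this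
  have tB : Tendsto (fun n => ∫ z : ℝ × ℝ, (ρ n).normed volume (z.2 - z.1) *
      (φ z.1 * u' z.1 (v z.2)) ∂((volume.restrict (Ioo 0 T)).prod (volume.restrict (Ioo 0 T))))
      atTop (𝓝 (∫ t in Ioo 0 T, φ t * u' t (v t))) := by
    have := tendsto_mollified_duality hp hp' (F := fun t => φ t • u' t) (w := v)
      (memLp_smul_of_hasCompactSupport hf hφ.continuous hφc)
      (memLp_smul_of_hasCompactSupport hg hφ.continuous hφc)
      (hfg.mono fun t ht z => by simp [ht z, mul_add]) hv.memLp_sob (hv.memLp_fn p') hρ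
    simpa only [smul_apply, smul_eq_mul] using this
  have tC : Tendsto (fun n => ∫ z : ℝ × ℝ, (ρ n).normed volume (z.2 - z.1) *
      (φ z.1 * v' z.2 (u z.1)) ∂((volume.restrict (Ioo 0 T)).prod (volume.restrict (Ioo 0 T))))
      atTop (𝓝 (∫ t in Ioo 0 T, φ t * v' t (u t))) := by
    have := tendsto_mollified_duality_swap hp hp' (F := v') (w := fun t => φ t • u t) hk hl hkl
      (memLp_smul_of_hasCompactSupport hu.memLp_sob hφ.continuous hφc)
      (memLp_smul_of_hasCompactSupport (hu.memLp_fn p') hφ.continuous hφc) hρ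
    simpa only [map_smul, smul_eq_mul] using this
  have hlim := tendsto_nhds_unique (tA.congr' ?_) (tB.add tC).neg
  · have i1 : IntegrableOn (fun t => φ t * u' t (v t)) (Ioo 0 T) :=
      integrableOn_smul_of_hasCompactSupport (hv.integrable_apply hu) hφ.continuous hφc
    have i2 : IntegrableOn (fun t => φ t * v' t (u t)) (Ioo 0 T) :=
      integrableOn_smul_of_hasCompactSupport (hu.integrable_apply hv) hφ.continuous hφc
    simp only [mul_add]
    rw [hlim, integral_add i1 i2]
  · have hsmall : ∀ᶠ n in atTop, (ρ n).rOut < min a (T - b) :=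
      hρ.eventually (gt_mem_nhds (lt_min ha (sub_pos.2 hb)))
    filter_upwards [hsmall] with n hn
    refine mollified_product_rule (V.toDual h2) (V.toDual_comm h2) measurableSet_Ioo
      hu.integrable hv.integrable hu.isTimeDeriv.integrable hv.isTimeDeriv.integrable
      (fun _ k1 k2 k3 z => hu.integral_deriv_mul_toDual h2 k1 k2 k3 z)
      (fun _ k1 k2 k3 z => hv.integral_deriv_mul_toDual h2 k1 k2 k3 z)
      hφ hφc hφT (ρ := (ρ n).normed volume) (ρ n).contDiff_normed
      (ρ n).hasCompactSupport_normed ?_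
    intro t ht r hr
    rw [(ρ n).tsupport_normed_eq, Metric.mem_closedBall, dist_zero_right, Real.norm_eq_abs,
      abs_le] at hr
    have h3 := hab ht
    have h4 := hn.trans_le (min_le_left _ _)
    have h5 := hn.trans_le (min_le_right _ _)
    exact ⟨by linarith [h3.1], by linarith [h3.2]⟩

theorem IsRegular.exists_inner_ae_eq [IsFiniteMeasure (volume.restrict Ω)] (h2 : 2 ≤ p')
    (hp : p ≠ ⊤) (hp' : p' ≠ ⊤) (hT : 0 < T) (hu : IsRegular T u u') (hv : IsRegular T v v') :
    ∃ c : ℝ, ∀ᵐ t ∂volume.restrict (Ioo 0 T), inner ℝ (V.l2 h2 (u t)) (V.l2 h2 (v t))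
      = c + ∫ s in (0 : ℝ)..t, (u' s (v s) + v' s (u s)) := by
  refine ae_eq_add_primitive hT ?_ ((hv.integrable_apply hu).add (hu.integrable_apply hv))
    fun φ hφ hφc hφT => hu.weak_product_rule h2 hp hp' hT hv hφ hφc hφT
  have : ENNReal.HolderConjugate p' p := ENNReal.HolderConjugate.symm
  exact memLp_one_iff_integrable.1
    ((innerSL ℝ : LSp Ω (E m) 2 →L[ℝ] LSp Ω (E m) 2 →L[ℝ] ℝ).memLp_of_bilin 1
      (hu.memLp_l2 h2 p) (hv.memLp_l2 h2 p'))

/-- The identity `u(t) = c + ∫₀ᵗ u'` in `V'`. In contrast to its tested versions it holds outside a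
null set of times that is independent of the test function, so that a value `u(s)` may be
inserted. -/
theorem IsRegular.exists_toDual_ae_eq [IsFiniteMeasure (volume.restrict Ω)] (h2 : 2 ≤ p')
    (hT : 0 < T) (hu : IsRegular T u u') :
    ∃ c, ∀ᵐ t ∂volume.restrict (Ioo 0 T), V.toDual h2 (u t) = c + ∫ s in (0 : ℝ)..t, u' s := by
  have hi : IntegrableOn (fun t => V.toDual h2 (u t)) (Ioo 0 T) :=
    (V.toDual h2).integrable_comp hu.integrable
  refine ae_eq_add_primitive hT hi hu.isTimeDeriv.integrable fun φ hφ hφc hφT => ?_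
  have hφ' : ContDiff ℝ ∞ (deriv φ) := (contDiff_infty_iff_deriv.1 hφ).2
  ext z
  rw [neg_apply, ContinuousLinearMap.integral_apply
      (integrableOn_smul_of_hasCompactSupport hi hφ'.continuous hφc.deriv),
    ContinuousLinearMap.integral_apply
      (integrableOn_smul_of_hasCompactSupport hu.isTimeDeriv.integrable hφ.continuous hφc)]
  exact hu.integral_deriv_mul_toDual h2 hφ hφc hφT z

end Evolution

/-! ### The continuous representative -/

section Continuity

/-- A function on a dense set that has the increments of a continuous function `K` as a modulus of
continuity extends continuously. -/
theorem exists_continuousOn_extension {H : Type*} [NormedAddCommGroup H] [CompleteSpace H]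
    {S B : Set ℝ} (hSB : S ⊆ B) (hBS : B ⊆ closure S) {h : ℝ → H} {K : ℝ → ℝ}
    (hK : ContinuousOn K B)
    (hh : ∀ s ∈ S, ∀ t ∈ S, ‖h t - h s‖ ≤ 2 * √|K t - K s|) :
    ∃ c : ℝ → H, ContinuousOn c B ∧ ∀ t ∈ S, c t = h t := by
  have hlim : ∀ x ∈ B, ∃ y, Tendsto h (𝓝[S] x) (𝓝 y) := by
    intro x hx
    have hne : (𝓝[S] x).NeBot := mem_closure_iff_nhdsWithin_neBot.1 (hBS hx)
    rw [← cauchy_map_iff_exists_tendsto, cauchy_map_iff]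
    refine ⟨hne, tendsto_uniformity_iff_dist_tendsto_zero.2 ?_⟩
    have hKx : Tendsto K (𝓝[S] x) (𝓝 (K x)) := (hK x hx).mono_left (nhdsWithin_mono x hSB)
    have hb : Tendsto (fun q : ℝ × ℝ => 2 * √|K q.1 - K q.2|) (𝓝[S] x ×ˢ 𝓝[S] x) (𝓝 0) := by
      have h1 : Tendsto (fun q : ℝ × ℝ => K q.1) (𝓝[S] x ×ˢ 𝓝[S] x) (𝓝 (K x)) :=
        hKx.comp tendsto_fst
      have h2 : Tendsto (fun q : ℝ × ℝ => K q.2) (𝓝[S] x ×ˢ 𝓝[S] x) (𝓝 (K x)) :=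
        hKx.comp tendsto_snd
      simpa using ((h1.sub h2).abs.sqrt).const_mul 2
    refine squeeze_zero' (Eventually.of_forall fun _ => dist_nonneg) ?_ hb
    have hm : ∀ᶠ q : ℝ × ℝ in 𝓝[S] x ×ˢ 𝓝[S] x, q.1 ∈ S ∧ q.2 ∈ S :=
      (eventually_mem_nhdsWithin (a := x) (s := S)).prod_mk eventually_mem_nhdsWithin
    filter_upwards [hm] with q hq
    rw [dist_eq_norm]
    exact hh _ hq.2 _ hq.1
  refine ⟨extendFrom S h, continuousOn_extendFrom hBS hlim, fun t ht => ?_⟩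
  refine extendFrom_eq (subset_closure ht) ?_
  have hKx : Tendsto K (𝓝[S] t) (𝓝 (K t)) := (hK t (hSB ht)).mono_left (nhdsWithin_mono t hSB)
  have hb : Tendsto (fun q => 2 * √|K q - K t|) (𝓝[S] t) (𝓝 0) := by
    simpa using ((hKx.sub_const (K t)).abs.sqrt).const_mul 2
  rw [tendsto_iff_norm_sub_tendsto_zero]
  refine squeeze_zero' (Eventually.of_forall fun _ => norm_nonneg _) ?_ hb
  filter_upwards [eventually_mem_nhdsWithin] with q hq
  exact hh _ ht _ hq

theorem intervalIntegrable_of_integrableOn_Ioo {F : Type*} [NormedAddCommGroup F] {T : ℝ}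
    {w : ℝ → F} (hw : IntegrableOn w (Ioo 0 T)) {s t : ℝ} (hs : s ∈ Icc 0 T) (ht : t ∈ Icc 0 T) :
    IntervalIntegrable w volume s t := by
  rw [← integrableOn_Icc_iff_integrableOn_Ioo] at hw
  exact (hw.mono_set (uIcc_subset_Icc hs ht)).intervalIntegrable

theorem continuousOn_primitive_Icc {F : Type*} [NormedAddCommGroup F] [NormedSpace ℝ F] {T : ℝ}
    (hT : 0 ≤ T) {w : ℝ → F} (hw : IntegrableOn w (Ioo 0 T)) :
    ContinuousOn (fun t => ∫ s in (0 : ℝ)..t, w s) (Icc 0 T) := by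
  rw [← integrableOn_Icc_iff_integrableOn_Ioo, ← uIcc_of_le hT] at hw
  simpa only [uIcc_of_le hT] using intervalIntegral.continuousOn_primitive_interval hw

theorem Icc_subset_closure_of_ae {T : ℝ} (hT : 0 < T) {P : ℝ → Prop}
    (hP : ∀ᵐ t ∂volume.restrict (Ioo 0 T), P t) : Icc 0 T ⊆ closure {t | t ∈ Ioo 0 T ∧ P t} := by
  rw [ae_restrict_iff' measurableSet_Ioo] at hP
  have h := (Measure.dense_of_ae hP).open_subset_closure_inter (isOpen_Ioo (a := (0 : ℝ)) (b := T))
  have h' : Ioo 0 T ∩ {t | t ∈ Ioo 0 T → P t} ⊆ {t | t ∈ Ioo 0 T ∧ P t} :=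
    fun t ht => ⟨ht.1, ht.2 ht.1⟩
  rw [← closure_Ioo hT.ne]
  exact closure_minimal (h.trans (closure_mono h')) isClosed_closure

theorem setIntegral_le_of_le_add_of_mean_le {a b : ℝ} (hab : a < b) {x y α γ : ℝ → ℝ} {r : ℝ}
    (hx : IntegrableOn x (Icc a b)) (hy : IntegrableOn y (Icc a b))
    (hα : IntegrableOn α (Icc a b)) (hγ : IntegrableOn γ (Icc a b))
    (hle : ∀ᵐ τ ∂volume.restrict (Icc a b), y τ ≤ α τ + r)
    (hr : (b - a) * r ≤ ∫ τ in Icc a b, γ τ) :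
    ∫ τ in Icc a b, (2 * x τ + 2 * y τ) ≤ ∫ τ in Icc a b, (2 * x τ + 2 * (α τ + γ τ)) := by
  have hri : IntegrableOn (fun _ : ℝ => r) (Icc a b) := integrableOn_const (by simp)
  have h1 : ∫ τ in Icc a b, y τ ≤ (∫ τ in Icc a b, α τ) + (b - a) * r := by
    refine (integral_mono_ae hy (hα.add hri) hle).trans_eq ?_
    rw [integral_add' hα hri, setIntegral_const, Real.volume_real_Icc_of_le hab.le, smul_eq_mul]
  have hαγ : IntegrableOn (fun τ => α τ + γ τ) (Icc a b) := hα.add hγ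
  rw [integral_add (hx.const_mul 2) (hy.const_mul 2), integral_add (hx.const_mul 2)
    (hαγ.const_mul 2), integral_const_mul, integral_const_mul, integral_const_mul,
    integral_add hα hγ]
  linarith

variable {d m : ℕ} {Ω : Set (E d)} {p p' : ℝ≥0∞} [Fact (1 ≤ p)] [Fact (1 ≤ p')]
  [ENNReal.HolderConjugate p p'] [IsFiniteMeasure (volume.restrict Ω)] {T : ℝ}
  {u v : ℝ → V Ω m p p'} {u' v' : ℝ → StrongDual ℝ (V Ω m p p')}

/-- The identity `‖u(t) - u(s)‖² = ∫ₛᵗ (2⟨u', u⟩ - 2⟨u', u(s)⟩)`, estimated over an interval that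
contains `s` and `t`. -/
theorem IsRegular.norm_sub_sq_le (h2 : 2 ≤ p') (hu : IsRegular T u u')
    {c : ℝ} {c' : StrongDual ℝ (V Ω m p p')} {s t a b : ℝ}
    (ha : 0 < a) (hb : b < T) (hs : s ∈ Icc a b) (ht : t ∈ Icc a b)
    (hcs : inner ℝ (V.l2 h2 (u s)) (V.l2 h2 (u s))
      = c + ∫ τ in (0 : ℝ)..s, (u' τ (u τ) + u' τ (u τ)))
    (hct : inner ℝ (V.l2 h2 (u t)) (V.l2 h2 (u t))
      = c + ∫ τ in (0 : ℝ)..t, (u' τ (u τ) + u' τ (u τ)))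
    (hds : V.toDual h2 (u s) = c' + ∫ τ in (0 : ℝ)..s, u' τ)
    (hdt : V.toDual h2 (u t) = c' + ∫ τ in (0 : ℝ)..t, u' τ) :
    ‖V.l2 h2 (u t) - V.l2 h2 (u s)‖ ^ 2
      ≤ ∫ τ in Icc a b, (2 * |u' τ (u τ)| + 2 * |u' τ (u s)|) := by
  have hsub : Icc a b ⊆ Ioo 0 T := fun x hx => ⟨ha.trans_le hx.1, hx.2.trans_lt hb⟩
  have hs' : s ∈ Icc 0 T := Ioo_subset_Icc_self (hsub hs)
  have ht' : t ∈ Icc 0 T := Ioo_subset_Icc_self (hsub ht)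
  have h0' : (0 : ℝ) ∈ Icc 0 T := ⟨le_rfl, hs'.1.trans hs'.2⟩
  have ie := hu.integrable_apply hu
  have ie2 : IntegrableOn (fun τ => u' τ (u τ) + u' τ (u τ)) (Ioo 0 T) := ie.add ie
  have iz : IntegrableOn (fun τ => u' τ (u s)) (Ioo 0 T) :=
    (ContinuousLinearMap.apply ℝ ℝ (u s)).integrable_comp hu.isTimeDeriv.integrable
  have e1 : inner ℝ (V.l2 h2 (u t)) (V.l2 h2 (u t)) - inner ℝ (V.l2 h2 (u s)) (V.l2 h2 (u s))
      = ∫ τ in s..t, (u' τ (u τ) + u' τ (u τ)) := by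
    rw [hcs, hct, ← intervalIntegral.integral_interval_sub_left
      (intervalIntegrable_of_integrableOn_Ioo ie2 h0' ht')
      (intervalIntegrable_of_integrableOn_Ioo ie2 h0' hs')]
    ring
  have e2 : V.toDual h2 (u t) (u s) - V.toDual h2 (u s) (u s) = ∫ τ in s..t, u' τ (u s) := by
    rw [← sub_apply, hds, hdt, add_sub_add_left_eq_sub,
      intervalIntegral.integral_interval_sub_left
      (intervalIntegrable_of_integrableOn_Ioo hu.isTimeDeriv.integrable h0' ht')
      (intervalIntegrable_of_integrableOn_Ioo hu.isTimeDeriv.integrable h0' hs'),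
      ContinuousLinearMap.intervalIntegral_apply
      (intervalIntegrable_of_integrableOn_Ioo hu.isTimeDeriv.integrable hs' ht')]
  have e3 : ‖V.l2 h2 (u t) - V.l2 h2 (u s)‖ ^ 2
      = ∫ τ in s..t, (u' τ (u τ) + u' τ (u τ) - 2 * u' τ (u s)) := by
    rw [intervalIntegral.integral_sub (intervalIntegrable_of_integrableOn_Ioo ie2 hs' ht')
      ((intervalIntegrable_of_integrableOn_Ioo iz hs' ht').const_mul 2),
      intervalIntegral.integral_const_mul, ← e1, ← e2, V.toDual_apply, V.toDual_apply,
      norm_sub_sq_real, ← real_inner_self_eq_norm_sq, ← real_inner_self_eq_norm_sq]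
    ring
  have i4 : IntegrableOn (fun τ => 2 * |u' τ (u τ)| + 2 * |u' τ (u s)|) (Icc a b) :=
    ((ie.abs.const_mul 2).add (iz.abs.const_mul 2)).mono_measure
      (Measure.restrict_mono hsub le_rfl)
  rw [e3]
  refine (le_abs_self _).trans ((intervalIntegral.norm_integral_le_integral_norm_uIoc
    (f := fun τ => u' τ (u τ) + u' τ (u τ) - 2 * u' τ (u s))).trans ?_)
  have hsub2 : uIoc s t ⊆ Icc a b := uIoc_subset_uIcc.trans (uIcc_subset_Icc hs ht)
  refine (setIntegral_mono_on ?_ (i4.mono_set hsub2) measurableSet_uIoc fun τ _ => ?_).trans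
    (setIntegral_mono_set i4 (ae_of_all _ fun τ => by positivity) hsub2.eventuallyLE)
  · exact (((ie2.sub (iz.const_mul 2)).norm).mono_measure
      (Measure.restrict_mono (hsub2.trans hsub) le_rfl))
  · rw [Real.norm_eq_abs]
    refine (abs_sub _ _).trans ?_
    rw [abs_mul, abs_two]
    gcongr
    exact (abs_add_le _ _).trans (by linarith)

/-- The term `‖g(τ)‖ ‖u(s)‖` that bounds `⟨g(τ), u(s)⟩` is not controlled for an arbitrary `s`, as
`u` is only `p`-integrable with values in `W_0^{1,p}`. For an `s` at which `‖u(s)‖ᵖ` is at most its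
mean over `[a, b]`, Young's inequality bounds its integral over `[a, b]` by that of
`‖g‖^{p'} + ‖u‖ᵖ`. -/
theorem IsRegular.exists_bound_norm_sub_sq (h2 : 2 ≤ p') (hp : p ≠ ⊤) (hp' : p' ≠ ⊤) (hT : 0 < T)
    (hu : IsRegular T u u') :
    ∃ (P : ℝ → Prop) (κ : ℝ → ℝ), (∀ᵐ t ∂volume.restrict (Ioo 0 T), P t) ∧
      IntegrableOn κ (Ioo 0 T) ∧ ∀ a ∈ Ioo 0 T, ∀ b ∈ Ioo 0 T, a < b → ∃ s, ∀ t ∈ Icc a b, P t →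
        ‖V.l2 h2 (u t) - V.l2 h2 (u s)‖ ^ 2 ≤ ∫ τ in Icc a b, κ τ := by
  obtain ⟨f, g, hf, hg, hfg⟩ := hu.split
  obtain ⟨M, hM⟩ := hu.bound
  obtain ⟨c, hc⟩ := hu.exists_inner_ae_eq h2 hp hp' hT hu
  obtain ⟨c', hc'⟩ := hu.exists_toDual_ae_eq h2 hT
  have hp0 : p ≠ 0 := (zero_lt_one.trans_le (Fact.out : 1 ≤ p)).ne'
  have hp0' : p' ≠ 0 := (zero_lt_one.trans_le (Fact.out : 1 ≤ p')).ne'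
  set D : ℝ := ‖dualPairing m Ω p p'‖ with hD
  set γ : ℝ → ℝ := fun t => ‖(u t).sob‖ ^ p.toReal with hγ
  have iγ : IntegrableOn γ (Ioo 0 T) := hu.memLp_sob.integrable_norm_rpow hp0 hp
  have iβ : IntegrableOn (fun t => ‖g t‖ ^ p'.toReal) (Ioo 0 T) :=
    hg.integrable_norm_rpow hp0' hp'
  have iα : IntegrableOn (fun t => D * ‖f t‖ * |M|) (Ioo 0 T) :=
    (((hf.integrable Fact.out).norm).const_mul _).mul_const _
  have jx : IntegrableOn (fun t => |u' t (u t)|) (Ioo 0 T) := (hu.integrable_apply hu).abs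
  have jα : IntegrableOn (fun t => D * ‖f t‖ * |M| + ‖g t‖ ^ p'.toReal) (Ioo 0 T) := iα.add iβ
  have hconj : Real.HolderConjugate p.toReal p'.toReal :=
    ENNReal.HolderConjugate.toReal_of_ne_top hp hp'
  let P : ℝ → Prop := fun t => ‖(u t).fn‖ ≤ M ∧ inner ℝ (V.l2 h2 (u t)) (V.l2 h2 (u t))
      = c + ∫ τ in (0 : ℝ)..t, (u' τ (u τ) + u' τ (u τ)) ∧
      V.toDual h2 (u t) = c' + ∫ τ in (0 : ℝ)..t, u' τ
  have hP : ∀ᵐ t ∂volume.restrict (Ioo 0 T), P t := hM.and (hc.and hc')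
  refine ⟨P, fun τ => 2 * |u' τ (u τ)| + 2 * (D * ‖f τ‖ * |M| + ‖g τ‖ ^ p'.toReal + γ τ), hP,
    (jx.const_mul 2).add ((jα.add iγ).const_mul 2), fun a ha b hb hab => ?_⟩
  have hsub : Icc a b ⊆ Ioo 0 T := fun x hx => ⟨ha.1.trans_le hx.1, hx.2.trans_lt hb.2⟩
  have hvol : volume (Icc a b) ≠ 0 := by simp [hab]
  -- A time `s` of `[a, b]` at which `γ` is at most its mean.
  obtain ⟨s, hs, hsγ⟩ := exists_notMem_null_le_average (μ := volume.restrict (Icc a b))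
    (N := {t | ¬ (t ∈ Icc a b ∧ P t)}) (by simpa using hvol) (iγ.mono_set hsub)
    (by
      rw [← compl_ofPred, ← mem_ae_iff]
      exact (ae_restrict_mem measurableSet_Icc).and
        (ae_mono (Measure.restrict_mono hsub le_rfl) hP))
  obtain ⟨hsI, hPs⟩ := not_not.1 hs
  have hmean : (b - a) * γ s ≤ ∫ τ in Icc a b, γ τ := by
    rw [setAverage_eq, Real.volume_real_Icc_of_le hab.le, smul_eq_mul, ← div_eq_inv_mul,
      le_div_iff₀ (sub_pos.2 hab)] at hsγ
    linarith
  refine ⟨s, fun t ht hPt => ?_⟩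
  have iz : IntegrableOn (fun τ => u' τ (u s)) (Ioo 0 T) :=
    (ContinuousLinearMap.apply ℝ ℝ (u s)).integrable_comp hu.isTimeDeriv.integrable
  have jy : IntegrableOn (fun τ => |u' τ (u s)|) (Ioo 0 T) := iz.abs
  refine (hu.norm_sub_sq_le h2 ha.1 hb.2 hsI ht hPs.2.1 hPt.2.1 hPs.2.2 hPt.2.2).trans ?_
  refine setIntegral_le_of_le_add_of_mean_le hab (jx.mono_set hsub)
    (jy.mono_set hsub) (jα.mono_set hsub) (iγ.mono_set hsub) ?_ hmean
  filter_upwards [ae_mono (Measure.restrict_mono hsub le_rfl) hfg] with τ hτ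
  have k1 : |dualPairing m Ω p p' (f τ) (u s).fn| ≤ D * ‖f τ‖ * |M| :=
    ((dualPairing m Ω p p').le_opNorm₂ _ _).trans
      (mul_le_mul_of_nonneg_left (hPs.1.trans (le_abs_self M)) (by positivity))
  have k2 : |g τ (u s).sob| ≤ ‖g τ‖ ^ p'.toReal + γ s := by
    refine ((g τ).le_opNorm _).trans ?_
    refine (Real.young_inequality_of_nonneg (norm_nonneg _) (norm_nonneg _)
      hconj.symm).trans ?_
    exact add_le_add (div_le_self (by positivity) hconj.symm.lt.le)
      (div_le_self (by positivity) hconj.lt.le)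
  rw [hτ (u s), add_assoc]
  exact (abs_add_le _ _).trans (add_le_add k1 k2)

theorem norm_sub_le_of_norm_sub_sq_le {H : Type*} [NormedAddCommGroup H] {x y z : H} {A : ℝ}
    (hx : ‖x - z‖ ^ 2 ≤ A) (hy : ‖y - z‖ ^ 2 ≤ A) : ‖x - y‖ ≤ 2 * √A := by
  have h1 := Real.le_sqrt_of_sq_le hx
  have h2 := Real.le_sqrt_of_sq_le hy
  have h3 := norm_sub_le_norm_sub_add_norm_sub x z y
  rw [norm_sub_rev z y] at h3
  linarith

theorem IsRegular.exists_modulus (h2 : 2 ≤ p') (hp : p ≠ ⊤) (hp' : p' ≠ ⊤) (hT : 0 < T)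
    (hu : IsRegular T u u') :
    ∃ (P : ℝ → Prop) (K : ℝ → ℝ), (∀ᵐ t ∂volume.restrict (Ioo 0 T), P t) ∧
      ContinuousOn K (Icc 0 T) ∧ ∀ s ∈ {t | t ∈ Ioo 0 T ∧ P t}, ∀ t ∈ {t | t ∈ Ioo 0 T ∧ P t},
        ‖V.l2 h2 (u t) - V.l2 h2 (u s)‖ ≤ 2 * √|K t - K s| := by
  obtain ⟨P, κ, hP, iκ, hκ⟩ := hu.exists_bound_norm_sub_sq h2 hp hp' hT
  refine ⟨P, fun t => ∫ τ in (0 : ℝ)..t, κ τ, hP, continuousOn_primitive_Icc hT.le iκ, ?_⟩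
  have key : ∀ a ∈ {t | t ∈ Ioo 0 T ∧ P t}, ∀ b ∈ {t | t ∈ Ioo 0 T ∧ P t}, a < b →
      ‖V.l2 h2 (u b) - V.l2 h2 (u a)‖
        ≤ 2 * √|(∫ τ in (0 : ℝ)..b, κ τ) - ∫ τ in (0 : ℝ)..a, κ τ| := by
    rintro a ⟨ha, hPa⟩ b ⟨hb, hPb⟩ hab
    obtain ⟨s, hs⟩ := hκ a ha b hb hab
    refine norm_sub_le_of_norm_sub_sq_le (z := V.l2 h2 (u s)) ?_ ?_
    all_goals
      rw [intervalIntegral.integral_interval_sub_left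
        (intervalIntegrable_of_integrableOn_Ioo iκ ⟨le_rfl, hT.le⟩ (Ioo_subset_Icc_self hb))
        (intervalIntegrable_of_integrableOn_Ioo iκ ⟨le_rfl, hT.le⟩ (Ioo_subset_Icc_self ha)),
        intervalIntegral.integral_of_le hab.le, ← integral_Icc_eq_integral_Ioc]
    · exact (hs b (right_mem_Icc.2 hab.le) hPb).trans (le_abs_self _)
    · exact (hs a (left_mem_Icc.2 hab.le) hPa).trans (le_abs_self _)
  intro s hs t ht
  rcases lt_trichotomy s t with h | rfl | h
  · exact key s hs t ht h
  · simp
  · rw [norm_sub_rev, abs_sub_comm]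
    exact key t ht s hs h

theorem IsRegular.exists_isContRep (h2 : 2 ≤ p') (hp : p ≠ ⊤) (hp' : p' ≠ ⊤) (hT : 0 < T)
    (hu : IsRegular T u u') : ∃ c, IsContRep T u c := by
  obtain ⟨P, K, hP, hK, hmod⟩ := hu.exists_modulus h2 hp hp' hT
  obtain ⟨c, hc, hcS⟩ := exists_continuousOn_extension
    (fun t ht => Ioo_subset_Icc_self ht.1) (Icc_subset_closure_of_ae hT hP)
    (h := fun t => V.l2 h2 (u t)) hK hmod
  refine ⟨c, hc, ?_⟩
  filter_upwards [hP, ae_restrict_mem measurableSet_Ioo] with t h1 h3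
  rw [hcS t ⟨h3, h1⟩]
  exact V.coeFn_l2 h2 (u t)

/-- The almost everywhere identity between `(u, v)` and the primitive of `⟨u', v⟩ + ⟨v', u⟩` extends
to every time of `[0, T]`, because both sides are continuous there. -/
theorem IsRegular.inner_sub_inner_eq (h2 : 2 ≤ p') (hp : p ≠ ⊤) (hp' : p' ≠ ⊤) (hT : 0 < T)
    (hu : IsRegular T u u') (hv : IsRegular T v v') {cu cv : ℝ → LSp Ω (E m) 2}
    (hcu : IsContRep T u cu) (hcv : IsContRep T v cv) {t : ℝ} (ht : t ∈ Icc 0 T) :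
    inner ℝ (cu t) (cv t) - inner ℝ (cu 0) (cv 0)
      = ∫ s in (0 : ℝ)..t, (u' s (v s) + v' s (u s)) := by
  obtain ⟨c, hc⟩ := hu.exists_inner_ae_eq h2 hp hp' hT hv
  have hi : IntegrableOn (fun s => u' s (v s) + v' s (u s)) (Ioo 0 T) :=
    (hv.integrable_apply hu).add (hu.integrable_apply hv)
  have hEq : EqOn (fun t => inner ℝ (cu t) (cv t))
      (fun t => c + ∫ s in (0 : ℝ)..t, (u' s (v s) + v' s (u s))) (Icc 0 T) := by
    refine Measure.eqOn_Icc_of_ae_eq (μ := volume) hT.ne ?_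
      (ContinuousOn.inner (𝕜 := ℝ) hcu.cont hcv.cont)
      (continuousOn_const.add (continuousOn_primitive_Icc hT.le hi))
    rw [← restrict_Ioo_eq_restrict_Icc]
    filter_upwards [hc, hcu.ae_eq_l2 h2, hcv.ae_eq_l2 h2] with t h1 h3 h4
    rw [h3, h4, h1]
  have e1 := hEq ht
  have e2 := hEq (left_mem_Icc.2 hT.le)
  simp only [intervalIntegral.integral_same, add_zero] at e1 e2
  rw [e1, e2]
  ring

end Continuity

end ParabolicIBP

end

open ParabolicIBP in
theorem propositionA3 (d m : ℕ) (Ω : Set (E d)) (hΩ : IsOpen Ω) (hconn : IsConnected Ω)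
    (hbdd : Bornology.IsBounded Ω) (T : ℝ) (hT : 0 < T)
    (p p' : ℝ≥0∞) [Fact (1 ≤ p)] [Fact (1 ≤ p')] (hp : 1 < p) (hp2 : p < 2)
    (hpp' : ENNReal.HolderConjugate p p')
    (u v : ℝ → V Ω m p p') (hu : MemW T u) (hv : MemW T v)
    (u' v' : ℝ → StrongDual ℝ (V Ω m p p'))
    (hu' : IsTimeDeriv T u u') (hv' : IsTimeDeriv T v v') :
    (∃ cu, IsContRep T u cu) ∧ (∃ cv, IsContRep T v cv) ∧
    IntegrableOn (fun τ => v' τ (u τ)) (Set.Ioo 0 T) ∧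
    IntegrableOn (fun τ => u' τ (v τ)) (Set.Ioo 0 T) ∧
    ∀ cu cv, IsContRep T u cu → IsContRep T v cv →
      ∀ t ∈ Set.Icc 0 T,
        ∫ τ in (0 : ℝ)..t, v' τ (u τ)
          = inner ℝ (cu t) (cv t) - inner ℝ (cu 0) (cv 0) - ∫ τ in (0 : ℝ)..t, u' τ (v τ) := by
  have hfin : IsFiniteMeasure ((volume : Measure (E d)).restrict Ω) :=
    ⟨by rw [Measure.restrict_apply_univ]; exact hbdd.measure_lt_top⟩
  have hpt : p ≠ ⊤ := hp2.ne_top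
  have hinv : p⁻¹ + p'⁻¹ = 1 := ENNReal.HolderConjugate.inv_add_inv_eq_one p p'
  have hpt' : p' ≠ ⊤ := by
    rintro rfl
    simp at hinv
    exact hp.ne' hinv
  have h2 : 2 ≤ p' := by
    by_contra! h
    have h1 : (2 : ℝ≥0∞)⁻¹ < p⁻¹ := ENNReal.inv_lt_inv.2 hp2
    have h3 : (2 : ℝ≥0∞)⁻¹ < p'⁻¹ := ENNReal.inv_lt_inv.2 h
    have := ENNReal.add_lt_add h1 h3
    rw [hinv, ENNReal.inv_two_add_inv_two] at this
    exact this.false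
  have hle : p ≤ p' := hp2.le.trans h2
  have ru := hu.isRegular hpt' hle hu'
  have rv := hv.isRegular hpt' hle hv'
  have iuv := ru.integrable_apply rv
  have ivu := rv.integrable_apply ru
  refine ⟨ru.exists_isContRep h2 hpt hpt' hT, rv.exists_isContRep h2 hpt hpt' hT, iuv, ivu,
    fun cu cv hcu hcv t ht => ?_⟩
  have h0 : (0 : ℝ) ∈ Set.Icc 0 T := Set.left_mem_Icc.2 hT.le
  rw [ru.inner_sub_inner_eq h2 hpt hpt' hT rv hcu hcv ht, intervalIntegral.integral_add
    (intervalIntegrable_of_integrableOn_Ioo ivu h0 ht)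
    (intervalIntegrable_of_integrableOn_Ioo iuv h0 ht), add_sub_cancel_left]
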